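/- **Setting.** Let $\mathcal S\times\mathcal A$ be a compact topological space with its Borel $\sigma$-algebra (equal to the product $\sigma$-algebra). Consider a Markov decision process with initial distribution $S_1$, reward distributions $R(s,a)$ on $[0,1]$ and transition distributions $T(s,a)$, a policy $\pi$, a horizon $1\le H<\infty$ and a discount factor $\gamma\in[0,1]$; put $C=\sum_{h=1}^H\gamma^{h-1}$. Let $P_h$ be the law of $(s_h,a_h)$ under $\pi$, let $\mu$ be a probability distribution on $\mathcal S\times\mathcal A$ with full support, and assume $P_h\ll\mu$ with $w_h=dP_h/d\mu$ for $1\le h\le H$. The data are i.i.d. copies $(u_i,r_i,u_i')$, $i=1,2,\dots$, with $u_i=(\tilde s_i,\tilde a_i)\sim\mu$ and, given $u_i$, independently $r_i\sim R(u_i)$ and $u_i'=(s',a')$, $s'\sim T(u_i)$, $a'\sim\pi(s')$. All functions are measurable. $B_\pi f(s,a)=\mathbb E[R(s,a)+\gamma f(s',\pi(s'))\mid s'\sim T(s,a)]$ is the Bellman operator, $\Omega$ is the set of all maps $X$ from the set of functions $\mathcal S\times\mathcal A\to[0,C]$ to itself, $\Delta X=X-B_\pi$, $Q^X_h=X^h0$,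 $Q^X=Q^X_H$, $J(Q)=\mathbb E[Q(s_1,\pi(s_1))]$, $Q^\pi(s,a)=\mathbb E^\pi[\sum_{h=1}^H\gamma^{h-1}r_h\mid s_1=s,a_1=a]$ and $\Delta J(Q)=J(Q)-J(Q^\pi)$. Let $\kappa$ be a continuous, symmetric, positive definite kernel on $\mathcal S\times\mathcal A$ with $\sup_u|\kappa(u,u)|\le1$ whose reproducing kernel Hilbert space $\mathcal F=\mathcal F_\kappa$ is dense in $L^1(\mu)$; $\|w\|_{\mathcal F}$ is the norm of a $\mu$-a.e. version of $w$ in $\mathcal F$, and $\infty$ if there is none. Put $\|g\|_{\mathcal F^*}=\sup_{\|f\|_{\mathcal F}\le1}\mathbb E_\mu[fg]$ and, for operators, $\|Y\|_{\mathcal F^*}=\sup_{f:\mathcal S\times\mathcal A\to[0,C]}\|Yf\|_{\mathcal F^*}$. Let (E) be the following property of $\varphi:[0,\infty)\to\mathbb R$: $\varphi$ is nonnegative, nondecreasing, continuous and concave, $\varphi(0)=0$, $\varphi(y)\le C\max_{1\le h\le H}\|w_h\|_{\mathcal F}\,y$ for all $y\ge0$, and $$|\Delta J(Q^X)|\le\varphi\Big(\frac1C\sum_{h=1}^H\gamma^{H-h}\|\Delta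 X\,Q^X_{h-1}\|_{\mathcal F^*}\Big)\quad\text{for all }X\in\Omega .$$ Let $$\varphi_{\mathcal F}(y)=\inf_{x>0}\Big\{(1+\gamma C)\sum_{h=1}^H\gamma^{h-1}\inf_{\|f\|_{\mathcal F}\le x}\|w_h-f\|_{L^1(\mu)}+C\,x\,y\Big\}.$$ For a finite nonempty $\mathcal X\subset\Omega$ let $\hat X_n$ be any minimizer over $X\in\mathcal X$ of the total kernel loss of the first $n$ data points, $$\frac1C\sum_{h=1}^H\gamma^{H-h}\sqrt{\mathcal L_n(X;Q^X_{h-1})},$$ where $$\mathcal L_n(X;f)=\frac1{n^2}\sum_{i,j=1}^n\kappa(u_i,u_j)\{r_i+\gamma f(u_i')-Xf(u_i)\}\{r_j+\gamma f(u_j')-Xf(u_j)\}.$$ **Claim.** The function $\varphi_{\mathcal F}$ has property (E). Moreover, for $\varphi=\varphi_{\mathcal F}$, and more generally for every $\varphi$ with property (E), let $\mathcal C_\kappa(X)=\varphi(\|\Delta X\|_{\mathcal F^*})$ and $\mathrm{Subopt}(Q)=\max\{0,|\Delta J(Q)|-\min_{X\in\mathcal X}\mathcal C_\kappa(X)\}$.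 Then: 1. $\mathcal C_\kappa$ is a selection criterion: $|\Delta J(Q^X)|\le\mathcal C_\kappa(X)$ for all $X\in\Omega$, and $\mathcal C_\kappa(B_\pi)=0$. 2. $\hat X_n$ is $\mathcal C_\kappa$-optimal: $\mathrm{Subopt}(Q^{\hat X_n})\to0$ in probability as $n\to\infty$. 3. For all $n\ge1$ and $\delta\in(0,1)$, with probability at least $1-\delta$, $$\mathrm{Subopt}(Q^{\hat X_n})\le K\,C^2\max_{1\le h\le H}\|w_h\|_{\mathcal F}\Big(\frac{\ln(H|\mathcal X|/\delta)}{n}\Big)^{1/4},$$ where $K$ is a universal constant (independent of all of the above). -/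

import Mathlib

open MeasureTheory ProbabilityTheory Filter
open scoped ENNReal

noncomputable section

namespace KLM

/-! ### The decision process and the offline data -/

/-- Offline policy evaluation problem: a Markov decision process with rewards in `[0, 1]`, a target
policy, a finite horizon `1 ≤ H`, a discount factor `γ ∈ [0, 1]`, and the query distribution `μ` of
the offline data. -/
structure OPEProblem (S A : Type*) [MeasurableSpace S] [MeasurableSpace A] where
  /-- initial state distribution -/
  init : Measure S
  /-- conditional reward distribution -/
  reward : Kernel (S × A) (Set.Icc (0 : ℝ) 1)
  /-- conditional distribution of the succeeding state -/
  trans : Kernel (S × A) S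
  /-- target policy -/
  policy : Kernel S A
  /-- time horizon -/
  H : ℕ
  /-- discount factor -/
  γ : ℝ
  /-- query distribution -/
  μ : Measure (S × A)
  init_prob : IsProbabilityMeasure init
  reward_markov : IsMarkovKernel reward
  trans_markov : IsMarkovKernel trans
  policy_markov : IsMarkovKernel policy
  μ_prob : IsProbabilityMeasure μ
  one_le_H : 1 ≤ H
  γ_nonneg : 0 ≤ γ
  γ_le_one : γ ≤ 1

attribute [instance] OPEProblem.init_prob OPEProblem.reward_markov OPEProblem.trans_markov
  OPEProblem.policy_markov OPEProblem.μ_prob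

namespace OPEProblem

variable {S A : Type*} [MeasurableSpace S] [MeasurableSpace A] (M : OPEProblem S A)

/-- The time constant `C = ∑_{h=1}^H γ^(h-1)`. -/
def C : ℝ := ∑ h ∈ Finset.range M.H, M.γ ^ h

lemma C_nonneg : 0 ≤ M.C := Finset.sum_nonneg fun _ _ => pow_nonneg M.γ_nonneg _

/-- The transition kernel of state-action pairs: from `(s, a)`, draw `s' ∼ T(s, a)` and then
`a' ∼ π(s')`. -/
def step : Kernel (S × A) (S × A) := M.trans ⊗ₖ Kernel.prodMkLeft (S × A) M.policy

/-- The law of the state-action pair after `k` steps of the chain when the first pair has law `ν`. -/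
def pairLaw (ν : Measure (S × A)) : ℕ → Measure (S × A)
  | 0 => ν
  | k + 1 => (pairLaw ν k).bind M.step

/-- The law `P₁` of `(s₁, a₁)`, with `s₁ ∼ S₁` and `a₁ ∼ π(s₁)`. -/
def initPair : Measure (S × A) := M.init ⊗ₘ M.policy

/-- `M.P k` is the law of the pair `(s_{k+1}, a_{k+1})`. -/
def P (k : ℕ) : Measure (S × A) := M.pairLaw M.initPair k

/-- Mean of the reward distribution `R(s, a)`. -/
def meanReward (u : S × A) : ℝ := ∫ r, (r : ℝ) ∂(M.reward u)

/-- The action-value function `Q^π(s, a) = E^π[∑_{h=1}^H γ^(h-1) r_h | s₁ = s, a₁ = a]`. -/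
def Qπ (u : S × A) : ℝ :=
  ∑ k ∈ Finset.range M.H, M.γ ^ k * ∫ v, M.meanReward v ∂(M.pairLaw (Measure.dirac u) k)

/-- `J(Q) = E[Q(s₁, π(s₁))]`. -/
def J (Q : S × A → ℝ) : ℝ := ∫ u, Q u ∂M.initPair

/-- The OPE error `ΔJ(Q) = J(Q) - J(Q^π)`. -/
def ΔJ (Q : S × A → ℝ) : ℝ := M.J Q - M.J M.Qπ

/-- The Bellman operator `(B_π f)(s, a) = E[R(s, a) + γ f(s', π(s'))]`, `s' ∼ T(s, a)`. -/
def bellman (f : S × A → ℝ) (u : S × A) : ℝ := M.meanReward u + M.γ * ∫ v, f v ∂(M.step u)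

/-- Sufficient exploration: the laws of `(s_h, a_h)`, `1 ≤ h ≤ H`, are absolutely continuous
with respect to `μ`. -/
def SufficientExploration : Prop := ∀ h < M.H, M.P h ≪ M.μ

/-- `M.w k` is the Radon–Nikodym derivative of the law of `(s_{k+1}, a_{k+1})`. -/
def w (k : ℕ) (u : S × A) : ℝ := ((M.P k).rnDeriv M.μ u).toReal

/-- The law of one data point `(u, r, u')`: `u = (s, a) ∼ μ`, `r ∼ R(s, a)`, and `u' = (s', a')` with
`s' ∼ T(s, a)`, `a' ∼ π(s')`. -/
def dataLaw : Measure ((S × A) × Set.Icc (0 : ℝ) 1 × (S × A)) := M.μ ⊗ₘ (M.reward ×ₖ M.step)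

/-! ### Operators -/

/-- Measurable functions `S × A → [0, C]`. -/
def Fn : Type _ := {f : S × A → ℝ // Measurable f ∧ ∀ u, f u ∈ Set.Icc 0 M.C}

/-- The class of range-bounded operators. -/
abbrev Op : Type _ := M.Fn → M.Fn

/-- The zero function. -/
def zeroFn : M.Fn := ⟨fun _ => 0, measurable_const, fun _ => ⟨le_rfl, M.C_nonneg⟩⟩

/-- `Q^X_h = X^h 0`. -/
def Qiter (X : M.Op) (h : ℕ) : M.Fn := X^[h] M.zeroFn

/-- `Q^X = X^H 0`. -/
def Qop (X : M.Op) : S × A → ℝ := (M.Qiter X M.H).1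

/-- An operator with values in `[0, C]` seen as one with values in all real functions. -/
def toFun (X : M.Op) : M.Fn → S × A → ℝ := fun f => (X f).1

/-- The Bellman operator on functions `S × A → [0, C]`. -/
def bellmanOp : M.Fn → S × A → ℝ := fun f => M.bellman f.1

/-- The Bellman error operator `ΔX = X - B_π`. It is defined for real-valued operators since
`B_π f` may exceed `C` when `f` takes values in `[0, C]`. -/
def Δ (X : M.Fn → S × A → ℝ) : M.Fn → S × A → ℝ := fun f u => X f u - M.bellmanOp f u

/-! ### Selection criteria and optimality -/

/-- A selection criterion bounds the OPE error of `Q^X` for every range-bounded `X` and vanishes at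
`B_π`. -/
def IsSelectionCriterion (c : (M.Fn → S × A → ℝ) → ℝ) : Prop :=
  (∀ X : M.Op, |M.ΔJ (M.Qop X)| ≤ c (M.toFun X)) ∧ c M.bellmanOp = 0

/-- `Subopt(Q; 𝒳, c) = max {0, |ΔJ(Q)| - min_{X ∈ 𝒳} c(X)}`. -/
def subopt (Q : S × A → ℝ) (cand : Finset M.Op) (hc : cand.Nonempty)
    (c : (M.Fn → S × A → ℝ) → ℝ) : ℝ :=
  max 0 (|M.ΔJ Q| - cand.inf' hc fun X => c (M.toFun X))

/-- `(𝒳, c)`-optimality of a sequence of random functions (`n` is the data size): the suboptimality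
tends to zero in probability. -/
def IsOptimal {Ω : Type*} [MeasurableSpace Ω] (Pr : Measure Ω) (Q : ℕ → Ω → S × A → ℝ)
    (cand : Finset M.Op) (hc : cand.Nonempty) (c : (M.Fn → S × A → ℝ) → ℝ) : Prop :=
  TendstoInMeasure Pr (fun n ω => M.subopt (Q n ω) cand hc c) atTop fun _ => 0

/-! ### Kernel losses -/

/-- The kernel Bellman loss of `X` at `f` on the data `z`. -/
def kernelLoss (κ : S × A → S × A → ℝ) {n : ℕ}
    (z : Fin n → (S × A) × Set.Icc (0 : ℝ) 1 × (S × A)) (X : M.Op) (f : M.Fn) : ℝ :=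
  1 / (n : ℝ) ^ 2 * ∑ i, ∑ j, κ (z i).1 (z j).1
    * (((z i).2.1 : ℝ) + M.γ * f.1 (z i).2.2 - (X f).1 (z i).1)
    * (((z j).2.1 : ℝ) + M.γ * f.1 (z j).2.2 - (X f).1 (z j).1)

/-- The total kernel loss. -/
def totalKernelLoss (κ : S × A → S × A → ℝ) {n : ℕ}
    (z : Fin n → (S × A) × Set.Icc (0 : ℝ) 1 × (S × A)) (X : M.Op) : ℝ :=
  1 / M.C * ∑ h ∈ Finset.range M.H,
    M.γ ^ (M.H - 1 - h) * √(M.kernelLoss κ z X (M.Qiter X h))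

/-- `X` minimizes the total kernel loss over the candidates. -/
def IsKLM (κ : S × A → S × A → ℝ) {n : ℕ}
    (z : Fin n → (S × A) × Set.Icc (0 : ℝ) 1 × (S × A)) (cand : Finset M.Op) (X : M.Op) : Prop :=
  X ∈ cand ∧ ∀ Y ∈ cand, M.totalKernelLoss κ z X ≤ M.totalKernelLoss κ z Y

/-! ### Norms attached to a reproducing kernel Hilbert space `F` of functions on `S × A` -/

section RKHSNorms

variable (F : Type*) [NormedAddCommGroup F] [InnerProductSpace ℝ F] [RKHS ℝ F (S × A) ℝ]

/-- `‖w‖_F` for a function `w` determined up to `μ`-null sets; it is `∞` when `w` has no version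
in `F`. -/
def rkhsNorm (w : S × A → ℝ) : ℝ≥0∞ := ⨅ (f : F) (_ : (f : S × A → ℝ) =ᵐ[M.μ] w), ‖f‖ₑ

/-- `max_{1 ≤ h ≤ H} ‖w_h‖_F`. -/
def wMax : ℝ≥0∞ := ⨆ h : Fin M.H, M.rkhsNorm F (M.w h)

/-- `F` is dense in `L¹(μ)`. -/
def DenseInL1 : Prop :=
  ∀ g : S × A → ℝ, Integrable g M.μ → ∀ ε > 0, ∃ f : F, ∫ u, |g u - f u| ∂M.μ < ε

/-- The dual norm `‖g‖_{F*} = sup_{‖f‖_F ≤ 1} E_μ[f g]`. -/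
def dualNorm (g : S × A → ℝ) : ℝ := ⨆ f : {f : F // ‖f‖ ≤ 1}, ∫ u, f.1 u * g u ∂M.μ

/-- The dual norm of an operator: the supremum of `‖Y f‖_{F*}` over all `f : S × A → [0, C]`. -/
def opDualNorm (Y : M.Fn → S × A → ℝ) : ℝ := ⨆ f : M.Fn, M.dualNorm F (Y f)

/-- The precriterion `(1 / C) ∑_{h=1}^H γ^(H-h) ‖ΔX Q^X_{h-1}‖_{F*}`. -/
def precriterion (X : M.Op) : ℝ :=
  1 / M.C * ∑ h ∈ Finset.range M.H,
    M.γ ^ (M.H - 1 - h) * M.dualNorm F (M.Δ (M.toFun X) (M.Qiter X h))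

/-- `inf_{‖f‖_F ≤ x} ‖w_h - f‖₁`. -/
def approxError (h : ℕ) (x : ℝ) : ℝ := ⨅ f : {f : F // ‖f‖ ≤ x}, ∫ u, |M.w h u - f.1 u| ∂M.μ

/-- The link function `φ_F(y) = inf_{x > 0} {(1 + γ C) ∑_{h=1}^H γ^(h-1) inf_{‖f‖_F ≤ x} ‖w_h - f‖₁
+ C x y}`. The factor `1 + γ C` is the uniform bound on `|ΔX f|`, `f : S × A → [0, C]`. -/
def link (y : ℝ) : ℝ :=
  ⨅ x : Set.Ioi (0 : ℝ), (1 + M.γ * M.C)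
    * ∑ h ∈ Finset.range M.H, M.γ ^ h * M.approxError F h x.1 + M.C * x.1 * y

/-- `φ` is a link function (nonnegative, nondecreasing, continuous and concave on `[0, ∞)`, zero at
`0`) with `φ(y) ≤ C max_h ‖w_h‖_F y` such that `φ` of the precriterion bounds the OPE error of every
range-bounded operator. -/
structure IsErrorLink (φ : ℝ → ℝ) : Prop where
  nonneg : ∀ y, 0 ≤ y → 0 ≤ φ y
  monotone : MonotoneOn φ (Set.Ici 0)
  continuous : ContinuousOn φ (Set.Ici 0)
  concave : ConcaveOn ℝ (Set.Ici 0) φ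
  zero : φ 0 = 0
  linear_bound : ∀ y, 0 ≤ y → ENNReal.ofReal (φ y) ≤ ENNReal.ofReal (M.C * y) * M.wMax F
  error_bound : ∀ X : M.Op, |M.ΔJ (M.Qop X)| ≤ φ (M.precriterion F X)

/-- The criterion `C_κ(X) = φ(‖ΔX‖_{F*})`. -/
def criterion (φ : ℝ → ℝ) (X : M.Fn → S × A → ℝ) : ℝ := φ (M.opDualNorm F (M.Δ X))

end RKHSNorms

end OPEProblem

/-- A continuous symmetric positive definite kernel, normalized by `κ(u, u) ≤ 1`. -/
structure IsNormalizedKernel {U : Type*} [TopologicalSpace U] (κ : U → U → ℝ) : Prop where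
  continuous : Continuous fun p : U × U => κ p.1 p.2
  symm : ∀ u v, κ u v = κ v u
  posDef : ∀ (s : Finset U) (c : U → ℝ), 0 ≤ ∑ u ∈ s, ∑ v ∈ s, c u * c v * κ u v
  normalized : ∀ u, |κ u u| ≤ 1

/-- The real reproducing kernel Hilbert space `F` of functions on `U` is generated by `κ`, i.e. its
reproducing kernel is `κ` (this determines `F` up to isometry). -/
def IsRKHSOf {U : Type*} (F : Type*) [NormedAddCommGroup F] [InnerProductSpace ℝ F]
    [CompleteSpace F] [RKHS ℝ F U ℝ] (κ : U → U → ℝ) : Prop :=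
  ∀ u v, RKHS.kernel F u v 1 = κ u v

end KLM

end

/-! The three claims rest on two facts about the dual norm `‖·‖_{F*}` of Bellman errors.

**Deterministic part.** Unrolling `Q^X = X^H 0` against the chain of state-action pairs gives the
telescoping identity `ΔJ_eq_sum`, which writes `ΔJ(Q^X)` as the sum over `h` of
`γ^(H-1-h) E_{P_{H-1-h}}[ΔX Q^X_h]` (steps counted from `0`). Each expectation is `E_μ[w g]` with
`g = ΔX Q^X_h` bounded by `1 + γ C`, and splitting `w = (w - f) + f` with `‖f‖_F ≤ x` bounds it by
`(1 + γ C) ‖w - f‖₁ + x ‖g‖_{F*}`; optimizing over `f` and `x` is the error bound for the link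
function `φ_F`. As an infimum of affine functions `φ_F` is concave and upper semicontinuous, density
of `F` in `L¹(μ)` gives `φ_F(0) = 0`, and taking `x` just above `max_h ‖w_h‖_F` gives the linear
bound.

**Statistical part.** With the feature map `u ↦ κ(·, u)`, the square root of the kernel loss is the
norm of the empirical mean of the `F`-valued vectors `residualFeature`, and the dual norm of the
Bellman error is the norm of their expectation (`dualNorm_eq_norm`, `integral_residualFeature`). The
two therefore differ by at most the deviation of an empirical mean in a Hilbert space, which is
sub-Gaussian (`measure_le_norm_average_sub_le`): by Hoeffding's lemma in the direction of the partial
sum, adding one centred summand `W` changes `E exp(θ ‖s‖²)` in a controlled way,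
`E exp(θ ‖s + W‖²) ≤ exp(θ b²) exp(θ (1 + 2 θ b²) ‖s‖²)`, and the resulting recursion for `1 / θ` is
linear in the sample size.

On the event that all `H |𝒳|` deviations are at most `ε`, the minimizer of the total kernel loss has
precriterion at most `2 ε` above that of any candidate, and subadditivity of `φ` bounds its
suboptimality by `φ(2 ε)` (`IsErrorLink.subopt_le`). Continuity of `φ` at `0` yields optimality, and
`φ(2 ε) ≤ 2 ε C max_h ‖w_h‖_F` with `ε = 12 C (ln(H |𝒳| / δ) / n)^(1/4)` yields the finite-sample
bound. -/

namespace KLM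

/-! ### Concentration of averages in Hilbert spaces -/

section Concentration

variable {F : Type*} [NormedAddCommGroup F] [InnerProductSpace ℝ F] [CompleteSpace F]
  [MeasurableSpace F] [BorelSpace F] [SecondCountableTopology F]

/-- One step of the exponential moment recursion: in `‖s + w‖² = ‖s‖² + 2⟪s, w⟫ + ‖w‖²` the cross term
is centred and bounded by `‖s‖ b`, so that Hoeffding's lemma applies to it. -/
lemma lintegral_exp_mul_norm_add_sq_le (ν : Measure F) [IsProbabilityMeasure ν] {b θ : ℝ}
    (hb : ∀ᵐ w ∂ν, ‖w‖ ≤ b) (h0 : ∫ w, w ∂ν = 0) (hθ : 0 ≤ θ) (s : F) :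
    ∫⁻ w, ENNReal.ofReal (Real.exp (θ * ‖s + w‖ ^ 2)) ∂ν
      ≤ ENNReal.ofReal (Real.exp (θ * b ^ 2))
        * ENNReal.ofReal (Real.exp (θ * (1 + 2 * θ * b ^ 2) * ‖s‖ ^ 2)) := by
  have hint : Integrable (fun w : F => w) ν :=
    Integrable.of_bound (by fun_prop) b hb
  have hIcc : ∀ᵐ w ∂ν, inner ℝ s w ∈ Set.Icc (-(‖s‖ * b)) (‖s‖ * b) := by
    filter_upwards [hb] with w hw
    have := abs_real_inner_le_norm s w
    have h2 : ‖s‖ * ‖w‖ ≤ ‖s‖ * b := by gcongr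
    exact abs_le.mp (this.trans h2)
  have hsub := hasSubgaussianMGF_of_mem_Icc_of_integral_eq_zero (μ := ν)
    (X := fun w => inner ℝ s w) (by fun_prop) hIcc (by
      rw [integral_inner hint s, h0, inner_zero_right])
  have hmgf := hsub.mgf_le (2 * θ)
  have hi := hsub.integrable_exp_mul (2 * θ)
  have hc : (((‖‖s‖ * b - -(‖s‖ * b)‖₊ / 2) ^ 2 : NNReal) : ℝ) = ‖s‖ ^ 2 * b ^ 2 := by
    push_cast
    rw [Real.norm_eq_abs, div_pow, sq_abs]
    ring
  rw [hc] at hmgf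
  calc ∫⁻ w, ENNReal.ofReal (Real.exp (θ * ‖s + w‖ ^ 2)) ∂ν
      ≤ ∫⁻ w, ENNReal.ofReal (Real.exp (θ * b ^ 2 + θ * ‖s‖ ^ 2))
          * ENNReal.ofReal (Real.exp (2 * θ * inner ℝ s w)) ∂ν := by
        refine lintegral_mono_ae ?_
        filter_upwards [hb] with w hw
        rw [← ENNReal.ofReal_mul (Real.exp_nonneg _), ← Real.exp_add, norm_add_sq_real]
        have hw2 : ‖w‖ ^ 2 ≤ b ^ 2 := by gcongr
        gcongr
        nlinarith [mul_le_mul_of_nonneg_left hw2 hθ]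
    _ = ENNReal.ofReal (Real.exp (θ * b ^ 2 + θ * ‖s‖ ^ 2))
          * ENNReal.ofReal (mgf (fun w => inner ℝ s w) ν (2 * θ)) := by
        rw [lintegral_const_mul _ (by fun_prop), mgf,
          ofReal_integral_eq_lintegral_ofReal hi (ae_of_all _ fun _ => Real.exp_nonneg _)]
    _ ≤ ENNReal.ofReal (Real.exp (θ * b ^ 2 + θ * ‖s‖ ^ 2))
          * ENNReal.ofReal (Real.exp (‖s‖ ^ 2 * b ^ 2 * (2 * θ) ^ 2 / 2)) := by
        gcongr
    _ = _ := by
        rw [← ENNReal.ofReal_mul (Real.exp_nonneg _), ← ENNReal.ofReal_mul (Real.exp_nonneg _),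
          ← Real.exp_add, ← Real.exp_add]
        congr 2
        ring

variable {Ω : Type*} [MeasurableSpace Ω] {Pr : Measure Ω} [IsProbabilityMeasure Pr]

/-- The weight `(c + 2 b² n)⁻¹` decreases with `n` just fast enough to absorb the factor `1 + 2 θ b²` by
which each new summand inflates the exponent. The bound is dimension free. -/
lemma lintegral_exp_norm_sum_sq_le {W : ℕ → Ω → F} (hW : ∀ i, Measurable (W i))
    (hind : iIndepFun W Pr) {b c : ℝ} (hc : 0 < c) (hb : ∀ i ω, ‖W i ω‖ ≤ b)
    (h0 : ∀ i, ∫ ω, W i ω ∂Pr = 0) (n : ℕ) :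
    ∫⁻ ω, ENNReal.ofReal (Real.exp ((c + 2 * b ^ 2 * n)⁻¹ * ‖∑ i ∈ Finset.range n, W i ω‖ ^ 2)) ∂Pr
      ≤ ENNReal.ofReal (Real.exp (n * (b ^ 2 / c))) := by
  induction n with
  | zero => simp
  | succ n ih =>
    set D : ℝ := c + 2 * b ^ 2 * n with hD
    have hcD : c ≤ D := le_add_of_nonneg_right (by positivity)
    have hDpos : 0 < D := hc.trans_le hcD
    have hD' : c + 2 * b ^ 2 * ((n + 1 : ℕ) : ℝ) = D + 2 * b ^ 2 := by
      rw [hD]; push_cast; ring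
    set θ : ℝ := (D + 2 * b ^ 2)⁻¹ with hθ
    have hθ0 : 0 ≤ θ := by positivity
    set T : Ω → F := fun ω => ∑ i ∈ Finset.range n, W i ω with hT
    have hTm : Measurable T := by fun_prop
    have hi : IndepFun T (W n) Pr := by
      have := hind.indepFun_finsetSum_of_notMem hW (i := n) (s := Finset.range n) (by simp)
      convert this using 1
      ext ω
      simp [hT]
    have hmap := (indepFun_iff_map_prod_eq_prod_map_map hTm.aemeasurable (hW n).aemeasurable).1 hi
    have : IsProbabilityMeasure (Pr.map (W n)) :=
      Measure.isProbabilityMeasure_map (hW n).aemeasurable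
    rw [hD']
    calc ∫⁻ ω, ENNReal.ofReal (Real.exp (θ * ‖∑ i ∈ Finset.range (n + 1), W i ω‖ ^ 2)) ∂Pr
        = ∫⁻ p, ENNReal.ofReal (Real.exp (θ * ‖p.1 + p.2‖ ^ 2))
            ∂(Pr.map fun ω => (T ω, W n ω)) := by
          rw [lintegral_map (by fun_prop) (by fun_prop)]
          simp only [Finset.sum_range_succ, hT]
      _ = ∫⁻ s, ∫⁻ w, ENNReal.ofReal (Real.exp (θ * ‖s + w‖ ^ 2)) ∂(Pr.map (W n))
            ∂(Pr.map T) := by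
          rw [hmap, lintegral_prod _ (by fun_prop)]
      _ ≤ ∫⁻ s, ENNReal.ofReal (Real.exp (θ * b ^ 2))
            * ENNReal.ofReal (Real.exp (D⁻¹ * ‖s‖ ^ 2)) ∂(Pr.map T) := by
          refine lintegral_mono fun s => ?_
          refine (lintegral_exp_mul_norm_add_sq_le _ (b := b) ?_ ?_ hθ0 s).trans ?_
          · rw [ae_map_iff (hW n).aemeasurable (measurableSet_le (by fun_prop) (by fun_prop))]
            exact ae_of_all _ (hb n)
          · rw [integral_map (hW n).aemeasurable (by fun_prop)]
            exact h0 n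
          · gcongr
            -- `θ (1 + 2 θ b²) ≤ 1 / D` amounts to `D (D + 4 b²) ≤ (D + 2 b²)²`.
            rw [hθ]
            field_simp
            nlinarith [sq_nonneg (b ^ 2)]
      _ = ENNReal.ofReal (Real.exp (θ * b ^ 2))
            * ∫⁻ ω, ENNReal.ofReal (Real.exp (D⁻¹ * ‖T ω‖ ^ 2)) ∂Pr := by
          rw [lintegral_const_mul _ (by fun_prop), lintegral_map (by fun_prop) hTm]
      _ ≤ ENNReal.ofReal (Real.exp (b ^ 2 / c))
            * ENNReal.ofReal (Real.exp (n * (b ^ 2 / c))) := by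
          gcongr
          rw [div_eq_inv_mul, hθ]
          gcongr
          linarith [sq_nonneg b]
      _ = _ := by
          rw [← ENNReal.ofReal_mul (Real.exp_nonneg _), ← Real.exp_add]
          congr 2
          push_cast
          ring

/-- Sub-Gaussian deviation bound for averages of bounded independent vectors with common mean `m`. -/
theorem measure_le_norm_average_sub_le {V : ℕ → Ω → F} (hV : ∀ i, Measurable (V i))
    (hind : iIndepFun V Pr) {B : ℝ} (hB : 0 < B) (hb : ∀ i ω, ‖V i ω‖ ≤ B) {m : F}
    (hm : ∀ i, ∫ ω, V i ω ∂Pr = m) {n : ℕ} (hn : 1 ≤ n) {ε : ℝ} (hε : 0 ≤ ε) :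
    Pr {ω | ε ≤ ‖(n : ℝ)⁻¹ • ∑ i ∈ Finset.range n, V i ω - m‖}
      ≤ ENNReal.ofReal (Real.exp (1 / 2 - n * ε ^ 2 / (16 * B ^ 2))) := by
  have hn0 : (0 : ℝ) < n := by exact_mod_cast hn
  have hmB : ‖m‖ ≤ B := by
    rw [← hm 0]
    simpa using norm_integral_le_of_norm_le_const (μ := Pr) (ae_of_all _ (hb 0))
  set W : ℕ → Ω → F := fun i ω => V i ω - m with hW
  have hWm : ∀ i, Measurable (W i) := fun i => (hV i).sub_const m
  have hWi : iIndepFun W Pr :=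
    hind.comp (fun _ v => v - m) (fun _ => measurable_id.sub_const m)
  have hWb : ∀ i ω, ‖W i ω‖ ≤ 2 * B := fun i ω =>
    (norm_sub_le _ _).trans (by linarith [hb i ω])
  have hW0 : ∀ i, ∫ ω, W i ω ∂Pr = 0 := fun i => by
    rw [hW, integral_sub (Integrable.of_bound (hV i).aestronglyMeasurable B (ae_of_all _ (hb i)))
      (integrable_const _), hm i]
    simp
  -- Taking `c` equal to `2 (2B)² n` keeps the exponential moment below `exp (1 / 2)`.
  have key := lintegral_exp_norm_sum_sq_le hWm hWi (c := 2 * (2 * B) ^ 2 * n) (by positivity)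
    hWb hW0 n
  have hden : (2 * (2 * B) ^ 2 * n + 2 * (2 * B) ^ 2 * n : ℝ) = 16 * B ^ 2 * n := by ring
  have hhalf : (n : ℝ) * ((2 * B) ^ 2 / (2 * (2 * B) ^ 2 * n)) = 1 / 2 := by
    field_simp
  rw [hden, hhalf] at key
  have hsub : {ω | ε ≤ ‖(n : ℝ)⁻¹ • ∑ i ∈ Finset.range n, V i ω - m‖} ⊆
      {ω | ENNReal.ofReal (Real.exp (n * ε ^ 2 / (16 * B ^ 2))) ≤
        ENNReal.ofReal (Real.exp ((16 * B ^ 2 * n)⁻¹ * ‖∑ i ∈ Finset.range n, W i ω‖ ^ 2))} := by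
    intro ω hω
    have hsum : ∑ i ∈ Finset.range n, W i ω
        = (n : ℝ) • ((n : ℝ)⁻¹ • ∑ i ∈ Finset.range n, V i ω - m) := by
      rw [smul_sub, smul_inv_smul₀ hn0.ne']
      simp [hW, Finset.sum_sub_distrib, Nat.cast_smul_eq_nsmul]
    simp only [Set.mem_ofPred_eq] at hω ⊢
    rw [hsum, norm_smul, Real.norm_of_nonneg hn0.le]
    gcongr
    have h2 : ε ^ 2 ≤ ‖(n : ℝ)⁻¹ • ∑ i ∈ Finset.range n, V i ω - m‖ ^ 2 := by gcongr
    rw [mul_pow]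
    calc n * ε ^ 2 / (16 * B ^ 2) = (16 * B ^ 2 * n)⁻¹ * (n ^ 2 * ε ^ 2) := by field_simp
      _ ≤ _ := by gcongr
  calc Pr _ ≤ _ := measure_mono hsub
    _ ≤ (∫⁻ ω, ENNReal.ofReal
          (Real.exp ((16 * B ^ 2 * n)⁻¹ * ‖∑ i ∈ Finset.range n, W i ω‖ ^ 2)) ∂Pr)
          / ENNReal.ofReal (Real.exp (n * ε ^ 2 / (16 * B ^ 2))) :=
        meas_ge_le_lintegral_div (by fun_prop)
          (by simpa using Real.exp_pos _) ENNReal.ofReal_ne_top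
    _ ≤ ENNReal.ofReal (Real.exp (1 / 2))
          / ENNReal.ofReal (Real.exp (n * ε ^ 2 / (16 * B ^ 2))) := by gcongr
    _ = _ := by
        rw [← ENNReal.ofReal_div_of_pos (Real.exp_pos _), Real.exp_sub]

end Concentration

end KLM

namespace KLM

/-! ### The feature map of a reproducing kernel Hilbert space -/

section FeatureMap

variable {U : Type*} (F : Type*) [NormedAddCommGroup F] [InnerProductSpace ℝ F] [CompleteSpace F]
  [RKHS ℝ F U ℝ]

/-- The canonical feature map `u ↦ κ(·, u)` of a reproducing kernel Hilbert space. -/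
noncomputable def feature (u : U) : F := RKHS.kerFun F u (1 : ℝ)

variable {F}

lemma inner_feature (f : F) (u : U) : inner ℝ f (feature F u) = f u := by
  simp [feature]

variable {κ : U → U → ℝ}

lemma IsRKHSOf.inner_feature_feature (h : IsRKHSOf F κ) (u v : U) :
    inner ℝ (feature F u) (feature F v) = κ u v := by
  rw [← h u v, ← RKHS.kerFun_apply, real_inner_comm]
  exact inner_feature _ _

variable [TopologicalSpace U]

lemma IsRKHSOf.norm_feature_le (h : IsRKHSOf F κ) (hκ : IsNormalizedKernel κ) (u : U) :
    ‖feature F u‖ ≤ 1 := by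
  have h1 := h.inner_feature_feature u u
  rw [real_inner_self_eq_norm_sq] at h1
  have h2 := (le_abs_self _).trans (hκ.normalized u)
  nlinarith [norm_nonneg (feature F u)]

lemma IsRKHSOf.continuous_feature (h : IsRKHSOf F κ) (hκ : IsNormalizedKernel κ) :
    Continuous (feature F : U → F) := by
  rw [continuous_iff_continuousAt]
  intro u
  have hc := hκ.continuous
  have hlim : Tendsto (fun v => √(κ v v - 2 * κ v u + κ u u)) (nhds u) (nhds 0) := by
    have hcont : Continuous fun v => √(κ v v - 2 * κ v u + κ u u) := by
      have h1 : Continuous fun v => κ v v := hc.comp (continuous_id.prodMk continuous_id)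
      have h2 : Continuous fun v => κ v u := hc.comp (continuous_id.prodMk continuous_const)
      fun_prop
    convert hcont.tendsto u using 2
    rw [← Real.sqrt_zero]
    congr 1
    ring
  rw [ContinuousAt, tendsto_iff_norm_sub_tendsto_zero]
  refine hlim.congr fun v => ?_
  rw [← h.inner_feature_feature, ← h.inner_feature_feature v u, ← h.inner_feature_feature u u,
    real_inner_self_eq_norm_sq, real_inner_self_eq_norm_sq, ← norm_sub_sq_real,
    Real.sqrt_sq (norm_nonneg _)]

/-- The feature map is continuous on a compact space, so its range is separable, and the span of its
range is dense. Measurability of `F`-valued sums needs this although `U` itself need not be second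
countable. -/
lemma IsRKHSOf.secondCountableTopology [CompactSpace U] (h : IsRKHSOf F κ)
    (hκ : IsNormalizedKernel κ) : SecondCountableTopology F := by
  have hsep : TopologicalSpace.IsSeparable (Set.range (feature F : U → F)) :=
    (isCompact_range (h.continuous_feature hκ)).isSeparable
  have hspan : TopologicalSpace.IsSeparable
      (closure (Submodule.span ℝ {RKHS.kerFun F x v | (x : U) (v : ℝ)} : Set F)) := by
    refine ((hsep.span (R := ℝ)).mono (Submodule.span_le.2 ?_)).closure
    rintro _ ⟨x, v, rfl⟩
    have : RKHS.kerFun F x v = v • feature F x := by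
      rw [feature, ← map_smul, smul_eq_mul, mul_one]
    rw [this]
    exact Submodule.smul_mem _ _ (Submodule.subset_span ⟨x, rfl⟩)
  have huniv : (closure (Submodule.span ℝ {RKHS.kerFun F x v | (x : U) (v : ℝ)} : Set F))
      = Set.univ := by
    rw [← Submodule.topologicalClosure_coe, RKHS.kerFun_dense]
    rfl
  rw [huniv, TopologicalSpace.isSeparable_univ_iff] at hspan
  exact UniformSpace.secondCountable_of_separable F

lemma IsRKHSOf.abs_apply_le (h : IsRKHSOf F κ) (hκ : IsNormalizedKernel κ) (f : F) (u : U) :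
    |f u| ≤ ‖f‖ := by
  rw [← inner_feature f u]
  refine (abs_real_inner_le_norm _ _).trans ?_
  exact mul_le_of_le_one_right (norm_nonneg _) (h.norm_feature_le hκ u)

lemma IsRKHSOf.measurable_coe [MeasurableSpace U] [BorelSpace U] (h : IsRKHSOf F κ)
    (hκ : IsNormalizedKernel κ) (f : F) : Measurable (f : U → ℝ) := by
  have : Continuous (f : U → ℝ) := by
    have := (h.continuous_feature hκ).inner (𝕜 := ℝ) (continuous_const (y := f))
    refine this.congr fun u => ?_
    rw [real_inner_comm, inner_feature]
  exact this.measurable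

lemma IsRKHSOf.integrable_coe [MeasurableSpace U] [BorelSpace U] (h : IsRKHSOf F κ)
    (hκ : IsNormalizedKernel κ) (μ : Measure U) [IsFiniteMeasure μ] (f : F) :
    Integrable (f : U → ℝ) μ :=
  Integrable.of_bound (h.measurable_coe hκ f).aestronglyMeasurable ‖f‖
    (ae_of_all _ (h.abs_apply_le hκ f))

end FeatureMap

end KLM

namespace KLM.OPEProblem

/-! ### Decomposition of the evaluation error along the chain -/

section ErrorDecomposition

variable {S A : Type*} [MeasurableSpace S] [MeasurableSpace A] (M : OPEProblem S A)

lemma one_le_C : 1 ≤ M.C := by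
  have h := Finset.single_le_sum (f := fun h => M.γ ^ h) (s := Finset.range M.H)
    (fun h _ => pow_nonneg M.γ_nonneg h) (Finset.mem_range.2 M.one_le_H)
  simpa [C] using h

lemma C_pos : 0 < M.C := zero_lt_one.trans_le M.one_le_C

lemma C_le_one_add : M.C ≤ 1 + M.γ * M.C := by
  have h : M.C + M.γ ^ M.H = 1 + M.γ * M.C := by
    rw [C, ← Finset.sum_range_succ, Finset.sum_range_succ', Finset.mul_sum, pow_zero, add_comm]
    simp only [pow_succ']
  linarith [pow_nonneg M.γ_nonneg M.H]

/-- Uses `1 ≤ C` and `γ ≤ 1`; it turns the range bound `1 + γ C` into a multiple of `C`. -/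
lemma one_add_le_two_mul_C : 1 + M.γ * M.C ≤ 2 * M.C := by
  nlinarith [M.one_le_C, M.γ_le_one]

lemma one_add_pos : 0 < 1 + M.γ * M.C := M.C_pos.trans_le M.C_le_one_add

lemma sum_weights : ∑ h ∈ Finset.range M.H, M.γ ^ (M.H - 1 - h) = M.C :=
  Finset.sum_range_reflect (fun h => M.γ ^ h) M.H

instance : IsMarkovKernel M.step := by unfold step; infer_instance

instance : IsProbabilityMeasure M.initPair := by unfold initPair; infer_instance

instance (ν : Measure (S × A)) [IsProbabilityMeasure ν] (k : ℕ) :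
    IsProbabilityMeasure (M.pairLaw ν k) := by
  induction k with
  | zero => simpa [pairLaw]
  | succ k ih => rw [pairLaw]; infer_instance

instance (k : ℕ) : IsProbabilityMeasure (M.P k) := by unfold P; infer_instance

instance : IsProbabilityMeasure M.dataLaw := by unfold dataLaw; infer_instance

lemma measurable_meanReward : Measurable M.meanReward := by
  have : StronglyMeasurable fun u => ∫ r : Set.Icc (0 : ℝ) 1, (r : ℝ) ∂(M.reward u) :=
    StronglyMeasurable.integral_kernel (κ := M.reward)
      (by exact measurable_subtype_coe.stronglyMeasurable)
  exact this.measurable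

lemma meanReward_mem (u : S × A) : M.meanReward u ∈ Set.Icc (0 : ℝ) 1 := by
  refine ⟨integral_nonneg fun r => r.2.1, ?_⟩
  have h := integral_mono_of_nonneg (μ := M.reward u) (ae_of_all _ fun r => r.2.1)
    (integrable_const (1 : ℝ)) (ae_of_all _ fun r => r.2.2)
  simpa [meanReward] using h

variable {M}

lemma Fn.measurable (f : M.Fn) : Measurable f.1 := f.2.1

lemma Fn.integrable (f : M.Fn) (ν : Measure (S × A)) [IsProbabilityMeasure ν] :
    Integrable f.1 ν :=
  Integrable.of_mem_Icc 0 M.C f.measurable.aemeasurable (ae_of_all _ f.2.2)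

lemma Fn.measurable_integral_step (f : M.Fn) : Measurable fun u => ∫ v, f.1 v ∂(M.step u) :=
  (StronglyMeasurable.integral_kernel (κ := M.step) f.measurable.stronglyMeasurable).measurable

lemma Fn.integral_step_mem (f : M.Fn) (u : S × A) :
    ∫ v, f.1 v ∂(M.step u) ∈ Set.Icc 0 M.C := by
  refine ⟨integral_nonneg fun v => (f.2.2 v).1, ?_⟩
  have h := integral_mono (f.integrable (M.step u)) (integrable_const M.C) fun v => (f.2.2 v).2
  simpa using h

lemma measurable_Δ (X : M.Op) (f : M.Fn) : Measurable (M.Δ (M.toFun X) f) :=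
  (X f).measurable.sub (M.measurable_meanReward.add (f.measurable_integral_step.const_mul _))

lemma abs_Δ_le (X : M.Op) (f : M.Fn) (u : S × A) :
    |M.Δ (M.toFun X) f u| ≤ 1 + M.γ * M.C := by
  have h1 := (X f).2.2 u
  have h2 := f.integral_step_mem u
  have h3 := M.meanReward_mem u
  have h4 := M.C_le_one_add
  have h5 : M.γ * ∫ v, f.1 v ∂(M.step u) ≤ M.γ * M.C :=
    mul_le_mul_of_nonneg_left h2.2 M.γ_nonneg
  have h6 : 0 ≤ M.γ * ∫ v, f.1 v ∂(M.step u) := mul_nonneg M.γ_nonneg h2.1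
  simp only [Δ, toFun, bellmanOp, bellman]
  rw [abs_le]
  constructor <;> linarith [h1.1, h1.2, h3.1, h3.2]

lemma integrable_Δ (X : M.Op) (f : M.Fn) (ν : Measure (S × A)) [IsProbabilityMeasure ν] :
    Integrable (M.Δ (M.toFun X) f) ν :=
  Integrable.of_bound (measurable_Δ X f).aestronglyMeasurable _ (ae_of_all _ (abs_Δ_le X f))

lemma integrable_meanReward (ν : Measure (S × A)) [IsProbabilityMeasure ν] :
    Integrable M.meanReward ν :=
  Integrable.of_mem_Icc 0 1 M.measurable_meanReward.aemeasurable (ae_of_all _ M.meanReward_mem)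

lemma integral_bind_kernel {α β : Type*} [MeasurableSpace α] [MeasurableSpace β] (ν : Measure α)
    (η : Kernel α β) {f : β → ℝ} (hf : Integrable f (ν.bind η)) :
    Integrable (fun a => ∫ b, f b ∂(η a)) ν ∧
      ∫ b, f b ∂(ν.bind η) = ∫ a, ∫ b, f b ∂(η a) ∂ν := by
  have h : ν.bind η = (η ∘ₖ Kernel.const Unit ν) () := by
    rw [Kernel.comp_apply, Kernel.const_apply]
  rw [h] at hf ⊢
  exact ⟨by simpa using hf.integral_comp, by simpa using Kernel.integral_comp hf⟩

lemma measurable_pairLaw_dirac (k : ℕ) :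
    Measurable fun u => M.pairLaw (Measure.dirac u) k := by
  induction k with
  | zero => exact Measure.measurable_dirac
  | succ k ih => exact (Measure.measurable_bind' M.step.measurable).comp ih

/-- The law of the chain is a mixture of the laws of the chains started at a point. -/
lemma pairLaw_eq_bind (ν : Measure (S × A)) (k : ℕ) :
    M.pairLaw ν k = ν.bind fun u => M.pairLaw (Measure.dirac u) k := by
  induction k with
  | zero => simp [pairLaw, Measure.bind_dirac]
  | succ k ih =>
    simp only [pairLaw]
    rw [← Measure.bind_bind (measurable_pairLaw_dirac k).aemeasurable M.step.measurable.aemeasurable,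
      ← ih]

lemma J_Qπ : M.J M.Qπ = ∑ k ∈ Finset.range M.H, M.γ ^ k * ∫ u, M.meanReward u ∂(M.P k) := by
  have key (k : ℕ) :
      Integrable (fun u => ∫ v, M.meanReward v ∂(M.pairLaw (Measure.dirac u) k)) M.initPair ∧
      ∫ u, ∫ v, M.meanReward v ∂(M.pairLaw (Measure.dirac u) k) ∂M.initPair
        = ∫ u, M.meanReward u ∂(M.P k) := by
    let η : Kernel (S × A) (S × A) := ⟨_, measurable_pairLaw_dirac (M := M) k⟩
    have hP : M.P k = M.initPair.bind η := pairLaw_eq_bind _ k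
    have hint := integrable_meanReward (M := M) (M.P k)
    rw [hP] at hint
    rw [hP]
    exact ⟨(integral_bind_kernel _ η hint).1, (integral_bind_kernel _ η hint).2.symm⟩
  unfold J Qπ
  rw [integral_finsetSum _ fun k _ => (key k).1.const_mul _]
  simp only [integral_const_mul, (key _).2]

lemma integral_P_succ (f : M.Fn) (k : ℕ) :
    ∫ u, f.1 u ∂(M.P (k + 1)) = ∫ u, ∫ v, f.1 v ∂(M.step u) ∂(M.P k) := by
  have hP : M.P (k + 1) = (M.P k).bind M.step := rfl
  have hint := f.integrable (M.P (k + 1))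
  rw [hP] at hint ⊢
  exact (integral_bind_kernel _ _ hint).2

/-- One Bellman step: `X f = ΔX f + r + γ E[f(u')]`, integrated against the law of a pair. -/
lemma integral_op (X : M.Op) (f : M.Fn) (k : ℕ) :
    ∫ u, (X f).1 u ∂(M.P k) = ∫ u, M.Δ (M.toFun X) f u ∂(M.P k)
      + ∫ u, M.meanReward u ∂(M.P k) + M.γ * ∫ u, f.1 u ∂(M.P (k + 1)) := by
  have hstep : Integrable (fun u => ∫ v, f.1 v ∂(M.step u)) (M.P k) :=
    Integrable.of_mem_Icc 0 M.C f.measurable_integral_step.aemeasurable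
      (ae_of_all _ f.integral_step_mem)
  have hΔ := integrable_Δ X f (M.P k)
  have hr := integrable_meanReward (M := M) (M.P k)
  calc ∫ u, (X f).1 u ∂(M.P k)
      = ∫ u, (M.Δ (M.toFun X) f u + M.meanReward u + M.γ * ∫ v, f.1 v ∂(M.step u)) ∂(M.P k) := by
        refine integral_congr_ae (ae_of_all _ fun u => ?_)
        simp only [Δ, toFun, bellmanOp, bellman]
        ring
    _ = _ := by
        rw [integral_P_succ, ← integral_const_mul, ← integral_add hΔ hr]
        exact integral_add (hΔ.add hr) (hstep.const_mul _)

/-- The evaluation error is the discounted sum of the Bellman errors of `X` along the chain. -/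
theorem ΔJ_eq_sum (X : M.Op) :
    M.ΔJ (M.Qop X) = ∑ h ∈ Finset.range M.H,
      M.γ ^ (M.H - 1 - h) * ∫ u, M.Δ (M.toFun X) (M.Qiter X h) u ∂(M.P (M.H - 1 - h)) := by
  have tele (n : ℕ) (hn : n ≤ M.H) :
      M.γ ^ (M.H - n) * ∫ u, (M.Qiter X n).1 u ∂(M.P (M.H - n))
        = ∑ h ∈ Finset.range n, M.γ ^ (M.H - 1 - h) *
          (∫ u, M.Δ (M.toFun X) (M.Qiter X h) u ∂(M.P (M.H - 1 - h))
            + ∫ u, M.meanReward u ∂(M.P (M.H - 1 - h))) := by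
    induction n with
    | zero =>
      have h0 : (M.Qiter X 0).1 = fun _ => 0 := rfl
      simp [h0]
    | succ n ih =>
      have hk : M.H - n = (M.H - 1 - n) + 1 := by omega
      have hk' : M.H - (n + 1) = M.H - 1 - n := by omega
      have hX : M.Qiter X (n + 1) = X (M.Qiter X n) := Function.iterate_succ_apply' _ _ _
      rw [Finset.sum_range_succ, ← ih (by omega), hk, hk', hX, integral_op, pow_succ]
      ring
  have h1 := tele M.H le_rfl
  rw [Nat.sub_self, pow_zero, one_mul] at h1
  have h2 := Finset.sum_range_reflect
    (fun k => M.γ ^ k * ∫ u, M.meanReward u ∂(M.P k)) M.H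
  have h3 : M.J (M.Qop X) = ∫ u, (M.Qiter X M.H).1 u ∂(M.P 0) := rfl
  rw [ΔJ, J_Qπ, h3, h1, ← h2, ← Finset.sum_sub_distrib]
  exact Finset.sum_congr rfl fun h _ => by ring

end ErrorDecomposition

end KLM.OPEProblem

namespace KLM.OPEProblem

/-! ### The dual norm -/

section DualNorm

variable {S A : Type*} [MeasurableSpace S] [MeasurableSpace A] [TopologicalSpace S]
  [TopologicalSpace A] [CompactSpace (S × A)] [BorelSpace (S × A)] {M : OPEProblem S A}
  {κ : S × A → S × A → ℝ}
  {F : Type*} [NormedAddCommGroup F] [InnerProductSpace ℝ F] [CompleteSpace F]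
  [RKHS ℝ F (S × A) ℝ]

lemma integrable_smul_feature (hF : IsRKHSOf F κ) (hκ : IsNormalizedKernel κ) {g : S × A → ℝ}
    (hg : Integrable g M.μ) : Integrable (fun u => g u • feature F u) M.μ := by
  have := hF.secondCountableTopology hκ
  refine hg.mono (hg.aestronglyMeasurable.smul
    (hF.continuous_feature hκ).aestronglyMeasurable) (ae_of_all _ fun u => ?_)
  rw [norm_smul]
  exact mul_le_of_le_one_right (norm_nonneg _) (hF.norm_feature_le hκ u)

lemma integral_mul_eq_inner (hF : IsRKHSOf F κ) (hκ : IsNormalizedKernel κ) {g : S × A → ℝ}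
    (hg : Integrable g M.μ) (f : F) :
    ∫ u, f u * g u ∂M.μ = inner ℝ f (∫ u, g u • feature F u ∂M.μ) := by
  rw [← integral_inner (integrable_smul_feature hF hκ hg)]
  refine integral_congr_ae (ae_of_all _ fun u => ?_)
  simp only [inner_smul_right, inner_feature, mul_comm]

/-- The dual norm of `g` is the norm of its kernel mean embedding, by the reproducing property. -/
theorem dualNorm_eq_norm (hF : IsRKHSOf F κ) (hκ : IsNormalizedKernel κ) {g : S × A → ℝ}
    (hg : Integrable g M.μ) :
    M.dualNorm F g = ‖∫ u, g u • feature F u ∂M.μ‖ := by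
  set m : F := ∫ u, g u • feature F u ∂M.μ with hm
  have hval (f : {f : F // ‖f‖ ≤ 1}) : ∫ u, f.1 u * g u ∂M.μ = inner ℝ f.1 m :=
    integral_mul_eq_inner hF hκ hg f.1
  have hle (f : {f : F // ‖f‖ ≤ 1}) : ∫ u, f.1 u * g u ∂M.μ ≤ ‖m‖ := by
    rw [hval]
    exact (real_inner_le_norm _ _).trans (mul_le_of_le_one_left (norm_nonneg _) f.2)
  have : Nonempty {f : F // ‖f‖ ≤ 1} := ⟨⟨0, by simp⟩⟩
  refine le_antisymm (ciSup_le hle) ?_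
  by_cases h0 : m = 0
  · refine le_ciSup_of_le ⟨‖m‖, by rintro _ ⟨f, rfl⟩; exact hle f⟩ ⟨0, by simp⟩ ?_
    simp [h0]
  · have hm0 : ‖m‖ ≠ 0 := norm_ne_zero_iff.2 h0
    refine le_ciSup_of_le ⟨‖m‖, by rintro _ ⟨f, rfl⟩; exact hle f⟩
      ⟨‖m‖⁻¹ • m, by rw [norm_smul, norm_inv, norm_norm, inv_mul_cancel₀ hm0]⟩ ?_
    rw [hval, real_inner_smul_left, real_inner_self_eq_norm_sq, sq, inv_mul_cancel_left₀ hm0]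

lemma dualNorm_nonneg (hF : IsRKHSOf F κ) (hκ : IsNormalizedKernel κ) {g : S × A → ℝ}
    (hg : Integrable g M.μ) : 0 ≤ M.dualNorm F g := by
  rw [dualNorm_eq_norm hF hκ hg]
  exact norm_nonneg _

lemma abs_integral_mul_le (hF : IsRKHSOf F κ) (hκ : IsNormalizedKernel κ) {g : S × A → ℝ}
    (hg : Integrable g M.μ) (f : F) :
    |∫ u, f u * g u ∂M.μ| ≤ ‖f‖ * M.dualNorm F g := by
  rw [integral_mul_eq_inner hF hκ hg, dualNorm_eq_norm hF hκ hg]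
  exact abs_real_inner_le_norm _ _

lemma dualNorm_Δ_le (hF : IsRKHSOf F κ) (hκ : IsNormalizedKernel κ) (X : M.Op) (f : M.Fn) :
    M.dualNorm F (M.Δ (M.toFun X) f) ≤ 1 + M.γ * M.C := by
  rw [dualNorm_eq_norm hF hκ (integrable_Δ X f _)]
  have h := norm_integral_le_of_norm_le_const (μ := M.μ) (C := 1 + M.γ * M.C)
    (f := fun u => M.Δ (M.toFun X) f u • feature F u) (ae_of_all _ fun u => by
      rw [norm_smul]
      exact (mul_le_of_le_one_right (norm_nonneg _) (hF.norm_feature_le hκ u)).trans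
        (abs_Δ_le X f u))
  simpa using h

lemma dualNorm_le_opDualNorm (hF : IsRKHSOf F κ) (hκ : IsNormalizedKernel κ) (X : M.Op)
    (f : M.Fn) :
    M.dualNorm F (M.Δ (M.toFun X) f) ≤ M.opDualNorm F (M.Δ (M.toFun X)) :=
  le_ciSup (f := fun f => M.dualNorm F (M.Δ (M.toFun X) f))
    ⟨1 + M.γ * M.C, by rintro _ ⟨f, rfl⟩; exact dualNorm_Δ_le hF hκ X f⟩ f

lemma precriterion_nonneg (hF : IsRKHSOf F κ) (hκ : IsNormalizedKernel κ) (X : M.Op) :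
    0 ≤ M.precriterion F X :=
  mul_nonneg (one_div_nonneg.2 M.C_nonneg) (Finset.sum_nonneg fun _ _ =>
    mul_nonneg (pow_nonneg M.γ_nonneg _) (dualNorm_nonneg hF hκ (integrable_Δ X _ _)))

lemma precriterion_le_opDualNorm (hF : IsRKHSOf F κ) (hκ : IsNormalizedKernel κ) (X : M.Op) :
    M.precriterion F X ≤ M.opDualNorm F (M.Δ (M.toFun X)) := by
  have hC := M.C_pos
  have h : ∑ h ∈ Finset.range M.H, M.γ ^ (M.H - 1 - h)
      * M.dualNorm F (M.Δ (M.toFun X) (M.Qiter X h))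
      ≤ M.C * M.opDualNorm F (M.Δ (M.toFun X)) := by
    rw [← M.sum_weights, Finset.sum_mul]
    refine Finset.sum_le_sum fun h _ => ?_
    exact mul_le_mul_of_nonneg_left (dualNorm_le_opDualNorm hF hκ X _) (pow_nonneg M.γ_nonneg _)
  rw [precriterion, one_div, inv_mul_le_iff₀ hC]
  exact h

end DualNorm

/-! ### The link function -/

section LinkFunction

variable {S A : Type*} [MeasurableSpace S] [MeasurableSpace A] {M : OPEProblem S A}
  {F : Type*} [NormedAddCommGroup F] [InnerProductSpace ℝ F] [RKHS ℝ F (S × A) ℝ]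

lemma integrable_w (k : ℕ) : Integrable (M.w k) M.μ := Measure.integrable_toReal_rnDeriv

lemma approxError_le {k : ℕ} {x : ℝ} (f : F) (hf : ‖f‖ ≤ x) :
    M.approxError F k x ≤ ∫ u, |M.w k u - f u| ∂M.μ :=
  ciInf_le_of_le ⟨0, by rintro _ ⟨g, rfl⟩; exact integral_nonneg fun _ => abs_nonneg _⟩
    ⟨f, hf⟩ le_rfl

lemma approxError_nonneg (k : ℕ) (x : ℝ) : 0 ≤ M.approxError F k x :=
  Real.iInf_nonneg fun _ => integral_nonneg fun _ => abs_nonneg _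

variable (M F) in
/-- The affine function of `y` whose infimum over `x > 0` is the link function. -/
noncomputable def linkTerm (x y : ℝ) : ℝ :=
  (1 + M.γ * M.C) * ∑ h ∈ Finset.range M.H, M.γ ^ h * M.approxError F h x + M.C * x * y

lemma linkTerm_nonneg {x y : ℝ} (hx : 0 < x) (hy : 0 ≤ y) : 0 ≤ M.linkTerm F x y :=
  add_nonneg (mul_nonneg M.one_add_pos.le (Finset.sum_nonneg fun h _ =>
    mul_nonneg (pow_nonneg M.γ_nonneg h) (approxError_nonneg h x)))
    (mul_nonneg (mul_nonneg M.C_nonneg hx.le) hy)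

lemma link_eq (y : ℝ) : M.link F y = ⨅ x : Set.Ioi (0 : ℝ), M.linkTerm F x.1 y := rfl

lemma bddBelow_linkTerm {y : ℝ} (hy : 0 ≤ y) :
    BddBelow (Set.range fun x : Set.Ioi (0 : ℝ) => M.linkTerm F x.1 y) :=
  ⟨0, by rintro _ ⟨x, rfl⟩; exact linkTerm_nonneg x.2 hy⟩

lemma link_le_linkTerm {x y : ℝ} (hx : 0 < x) (hy : 0 ≤ y) :
    M.link F y ≤ M.linkTerm F x y :=
  ciInf_le (bddBelow_linkTerm hy) (⟨x, hx⟩ : Set.Ioi (0 : ℝ))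

lemma link_nonneg {y : ℝ} (hy : 0 ≤ y) : 0 ≤ M.link F y :=
  Real.iInf_nonneg fun x => linkTerm_nonneg x.2 hy

lemma linkTerm_combo {x y z a b : ℝ} (hab : a + b = 1) :
    M.linkTerm F x (a * y + b * z) = a * M.linkTerm F x y + b * M.linkTerm F x z := by
  unfold linkTerm
  obtain rfl : b = 1 - a := by linarith
  ring

lemma monotoneOn_link : MonotoneOn (M.link F) (Set.Ici 0) := by
  intro y hy z _ hyz
  rw [link_eq z]
  refine le_ciInf fun x => (link_le_linkTerm x.2 hy).trans ?_
  have := mul_le_mul_of_nonneg_left hyz (mul_nonneg M.C_nonneg (le_of_lt x.2))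
  unfold linkTerm
  linarith

lemma concaveOn_link : ConcaveOn ℝ (Set.Ici 0) (M.link F) := by
  refine ⟨convex_Ici 0, fun y hy z hz a b ha hb hab => ?_⟩
  simp only [smul_eq_mul]
  rw [link_eq (a * y + b * z)]
  refine le_ciInf fun x => ?_
  rw [linkTerm_combo hab]
  exact add_le_add (mul_le_mul_of_nonneg_left (link_le_linkTerm x.2 hy) ha)
    (mul_le_mul_of_nonneg_left (link_le_linkTerm x.2 hz) hb)

/-- One radius serves all steps `k < H`, since the horizon is finite. -/
lemma exists_approxError_lt (hdense : M.DenseInL1 F) {ε : ℝ} (hε : 0 < ε) :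
    ∃ x : ℝ, 0 < x ∧ ∀ k, k < M.H → M.approxError F k x < ε := by
  choose f hf using fun k => hdense (M.w k) (integrable_w k) ε hε
  refine ⟨1 + ∑ k ∈ Finset.range M.H, ‖f k‖, by positivity, fun k hk => ?_⟩
  refine (approxError_le (f k) ?_).trans_lt (hf k)
  have := Finset.single_le_sum (f := fun k => ‖f k‖) (fun _ _ => norm_nonneg _)
    (Finset.mem_range.2 hk)
  linarith

lemma exists_linkTerm_zero_lt (hdense : M.DenseInL1 F) {ε : ℝ} (hε : 0 < ε) :
    ∃ x : ℝ, 0 < x ∧ M.linkTerm F x 0 < ε := by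
  have hB := M.one_add_pos
  have hC := M.C_pos
  obtain ⟨x, hx, h⟩ := exists_approxError_lt hdense
    (ε := ε / (2 * ((1 + M.γ * M.C) * M.C))) (by positivity)
  refine ⟨x, hx, ?_⟩
  have hs : ∑ h ∈ Finset.range M.H, M.γ ^ h * M.approxError F h x
      ≤ M.C * (ε / (2 * ((1 + M.γ * M.C) * M.C))) := by
    rw [C, Finset.sum_mul]
    refine Finset.sum_le_sum fun k hk => ?_
    exact mul_le_mul_of_nonneg_left (h k (Finset.mem_range.1 hk)).le (pow_nonneg M.γ_nonneg k)
  have h2 := mul_le_mul_of_nonneg_left hs hB.le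
  have h3 : (1 + M.γ * M.C) * (M.C * (ε / (2 * ((1 + M.γ * M.C) * M.C)))) = ε / 2 := by
    field_simp
  rw [linkTerm, mul_zero, add_zero]
  linarith

lemma link_zero (hdense : M.DenseInL1 F) : M.link F 0 = 0 := by
  refine le_antisymm (le_of_forall_pos_le_add fun ε hε => ?_) (link_nonneg le_rfl)
  obtain ⟨x, hx, h⟩ := exists_linkTerm_zero_lt hdense hε
  linarith [link_le_linkTerm (M := M) (F := F) hx le_rfl]

/-- Concavity gives continuity in the interior; at `0` the bound by a single affine term with small
value at `0` is needed. -/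
lemma continuousOn_link (hdense : M.DenseInL1 F) : ContinuousOn (M.link F) (Set.Ici 0) := by
  intro y hy
  rcases eq_or_lt_of_le (show (0 : ℝ) ≤ y from hy) with rfl | hy'
  · rw [ContinuousWithinAt, link_zero hdense]
    refine Metric.tendsto_nhdsWithin_nhds.2 fun ε hε => ?_
    obtain ⟨x, hx, h⟩ := exists_linkTerm_zero_lt hdense (half_pos hε)
    have hC := M.C_pos
    refine ⟨ε / (2 * (M.C * x)), by positivity, fun z hz hzd => ?_⟩
    have hz0 : (0 : ℝ) ≤ z := hz
    rw [Real.dist_eq, sub_zero, abs_of_nonneg hz0, lt_div_iff₀ (by positivity)] at hzd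
    rw [Real.dist_eq, sub_zero, abs_of_nonneg (link_nonneg hz0)]
    refine (link_le_linkTerm hx hz0).trans_lt ?_
    have : M.linkTerm F x z = M.linkTerm F x 0 + M.C * x * z := by unfold linkTerm; ring
    linarith
  · have h := (concaveOn_link (M := M) (F := F)).continuousOn_interior
    rw [interior_Ici] at h
    exact ((h y hy').continuousAt (Ioi_mem_nhds hy')).continuousWithinAt

/-- A radius above `max_h ‖w_h‖_F` makes all the approximation errors vanish. -/
lemma link_le_of_wMax_lt {x y : ℝ} (hx : 0 < x) (hy : 0 ≤ y)
    (hw : M.wMax F < ENNReal.ofReal x) : M.link F y ≤ M.C * x * y := by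
  have happ (k : ℕ) (hk : k < M.H) : M.approxError F k x = 0 := by
    have h1 : M.rkhsNorm F (M.w k) < ENNReal.ofReal x :=
      (le_iSup (fun h : Fin M.H => M.rkhsNorm F (M.w h)) ⟨k, hk⟩).trans_lt hw
    simp only [rkhsNorm, iInf_lt_iff] at h1
    obtain ⟨f, hf, hfx⟩ := h1
    have hfx' : ‖f‖ ≤ x := by
      rw [← ofReal_norm] at hfx
      exact ((ENNReal.ofReal_lt_ofReal_iff hx).1 hfx).le
    refine le_antisymm ((approxError_le f hfx').trans_eq ?_) (approxError_nonneg k x)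
    rw [integral_eq_zero_of_ae]
    filter_upwards [hf] with u hu
    simp [hu]
  refine (link_le_linkTerm hx hy).trans_eq ?_
  rw [linkTerm, Finset.sum_eq_zero fun k hk => by rw [happ k (Finset.mem_range.1 hk), mul_zero]]
  ring

/-- When `max_h ‖w_h‖_F = ∞` and `y = 0` the right-hand side is `0 * ∞ = 0`, and the bound is
`φ_F(0) = 0`. -/
lemma link_linear_bound (hdense : M.DenseInL1 F) {y : ℝ} (hy : 0 ≤ y) :
    ENNReal.ofReal (M.link F y) ≤ ENNReal.ofReal (M.C * y) * M.wMax F := by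
  rcases eq_or_lt_of_le hy with rfl | hy'
  · simp [link_zero hdense]
  have hCy : 0 < M.C * y := mul_pos M.C_pos hy'
  by_cases htop : M.wMax F = ∞
  · rw [htop, ENNReal.mul_top (by simpa using hCy)]
    exact le_top
  rw [← ENNReal.ofReal_toReal htop, ← ENNReal.ofReal_mul hCy.le]
  refine ENNReal.ofReal_le_ofReal (le_of_forall_pos_le_add fun ε hε => ?_)
  have hW := ENNReal.toReal_nonneg (a := M.wMax F)
  have h := link_le_of_wMax_lt (M := M) (F := F) (x := (M.wMax F).toReal + ε / (M.C * y))
    (by positivity) hy ((ENNReal.lt_ofReal_iff_toReal_lt htop).2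
      (lt_add_of_pos_right _ (by positivity)))
  refine h.trans_eq ?_
  have := M.C_pos
  field_simp

lemma opDualNorm_Δ_bellmanOp : M.opDualNorm F (M.Δ M.bellmanOp) = 0 := by
  have : Nonempty M.Fn := ⟨M.zeroFn⟩
  have : Nonempty {f : F // ‖f‖ ≤ 1} := ⟨⟨0, by simp⟩⟩
  simp [opDualNorm, dualNorm, Δ]

end LinkFunction

/-! ### The error bound and the selection criterion -/

section ErrorBound

variable {S A : Type*} [MeasurableSpace S] [MeasurableSpace A] [TopologicalSpace S]
  [TopologicalSpace A] [CompactSpace (S × A)] [BorelSpace (S × A)] {M : OPEProblem S A}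
  {κ : S × A → S × A → ℝ}
  {F : Type*} [NormedAddCommGroup F] [InnerProductSpace ℝ F] [CompleteSpace F]
  [RKHS ℝ F (S × A) ℝ]

/-- The change of measure to `μ` followed by the splitting `w = (w - f) + f`, optimized over `‖f‖ ≤ x`. -/
lemma abs_integral_P_le (hexp : M.SufficientExploration) (hF : IsRKHSOf F κ)
    (hκ : IsNormalizedKernel κ) {k : ℕ} (hk : k < M.H) {x : ℝ} (hx : 0 < x) (X : M.Op)
    (q : M.Fn) :
    |∫ u, M.Δ (M.toFun X) q u ∂(M.P k)| ≤ (1 + M.γ * M.C) * M.approxError F k x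
      + x * M.dualNorm F (M.Δ (M.toFun X) q) := by
  set g := M.Δ (M.toFun X) q with hg
  have hgi : Integrable g M.μ := integrable_Δ X q _
  have hgm : AEStronglyMeasurable g M.μ := hgi.aestronglyMeasurable
  have hB := M.one_add_pos
  have hgb (u : S × A) : |g u| ≤ 1 + M.γ * M.C := abs_Δ_le X q u
  have hw : ∫ u, g u ∂(M.P k) = ∫ u, M.w k u * g u ∂M.μ :=
    (integral_rnDeriv_smul (f := g) (hexp k hk)).symm
  have : Nonempty {f : F // ‖f‖ ≤ x} := ⟨⟨0, by simpa using hx.le⟩⟩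
  suffices h : (|∫ u, g u ∂(M.P k)| - x * M.dualNorm F g) / (1 + M.γ * M.C)
      ≤ M.approxError F k x by
    rw [div_le_iff₀' hB] at h
    linarith
  refine le_ciInf fun f => ?_
  rw [div_le_iff₀' hB]
  have hdiff : Integrable (fun u => M.w k u - f.1 u) M.μ :=
    (integrable_w k).sub (hF.integrable_coe hκ M.μ f.1)
  have i1 : Integrable (fun u => (M.w k u - f.1 u) * g u) M.μ :=
    hdiff.mul_bdd hgm (ae_of_all _ hgb)
  have i2 : Integrable (fun u => f.1 u * g u) M.μ :=
    (hF.integrable_coe hκ M.μ f.1).mul_bdd hgm (ae_of_all _ hgb)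
  have hsplit : ∫ u, M.w k u * g u ∂M.μ
      = ∫ u, (M.w k u - f.1 u) * g u ∂M.μ + ∫ u, f.1 u * g u ∂M.μ := by
    rw [← integral_add i1 i2]
    exact integral_congr_ae (ae_of_all _ fun u => by ring)
  have h1 : |∫ u, (M.w k u - f.1 u) * g u ∂M.μ|
      ≤ (1 + M.γ * M.C) * ∫ u, |M.w k u - f.1 u| ∂M.μ := by
    rw [← integral_const_mul]
    refine (abs_integral_le_integral_abs).trans (integral_mono i1.abs (hdiff.abs.const_mul _) ?_)
    intro u
    dsimp only
    rw [abs_mul, mul_comm]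
    exact mul_le_mul_of_nonneg_right (hgb u) (abs_nonneg _)
  have h2 : |∫ u, f.1 u * g u ∂M.μ| ≤ x * M.dualNorm F g :=
    (abs_integral_mul_le hF hκ hgi f.1).trans
      (mul_le_mul_of_nonneg_right f.2 (dualNorm_nonneg hF hκ hgi))
  rw [hw, hsplit]
  linarith [abs_add_le (∫ u, (M.w k u - f.1 u) * g u ∂M.μ) (∫ u, f.1 u * g u ∂M.μ)]

lemma abs_ΔJ_le_link (hexp : M.SufficientExploration) (hF : IsRKHSOf F κ)
    (hκ : IsNormalizedKernel κ) (X : M.Op) :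
    |M.ΔJ (M.Qop X)| ≤ M.link F (M.precriterion F X) := by
  have hC := M.C_pos
  rw [link_eq]
  refine le_ciInf fun x => ?_
  have hsum := Finset.sum_range_reflect (fun k => M.γ ^ k * M.approxError F k x.1) M.H
  have hpre : M.C * x.1 * M.precriterion F X = x.1 * ∑ h ∈ Finset.range M.H,
      M.γ ^ (M.H - 1 - h) * M.dualNorm F (M.Δ (M.toFun X) (M.Qiter X h)) := by
    rw [precriterion]
    field_simp
  rw [ΔJ_eq_sum, linkTerm, hpre, ← hsum, Finset.mul_sum, Finset.mul_sum, ← Finset.sum_add_distrib]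
  refine (Finset.abs_sum_le_sum_abs _ _).trans (Finset.sum_le_sum fun h hh => ?_)
  have hH := M.one_le_H
  have hp := pow_nonneg M.γ_nonneg (M.H - 1 - h)
  rw [abs_mul, abs_of_nonneg hp]
  refine (mul_le_mul_of_nonneg_left (abs_integral_P_le (k := M.H - 1 - h) hexp hF hκ (by omega)
    x.2 X (M.Qiter X h)) hp).trans_eq ?_
  ring

theorem isErrorLink_link (hexp : M.SufficientExploration) (hF : IsRKHSOf F κ)
    (hκ : IsNormalizedKernel κ) (hdense : M.DenseInL1 F) : M.IsErrorLink F (M.link F) where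
  nonneg _ hy := link_nonneg hy
  monotone := monotoneOn_link
  continuous := continuousOn_link hdense
  concave := concaveOn_link
  zero := link_zero hdense
  linear_bound _ hy := link_linear_bound hdense hy
  error_bound := abs_ΔJ_le_link hexp hF hκ

theorem IsErrorLink.isSelectionCriterion {φ : ℝ → ℝ} (hφ : M.IsErrorLink F φ)
    (hF : IsRKHSOf F κ) (hκ : IsNormalizedKernel κ) :
    M.IsSelectionCriterion (M.criterion F φ) := by
  refine ⟨fun X => (hφ.error_bound X).trans ?_, ?_⟩
  · have h0 := precriterion_nonneg hF hκ X
    have h1 := precriterion_le_opDualNorm hF hκ X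
    exact hφ.monotone h0 (h0.trans h1) h1
  · rw [criterion, opDualNorm_Δ_bellmanOp, hφ.zero]

end ErrorBound

end KLM.OPEProblem

namespace KLM.OPEProblem

/-! ### Kernel losses as norms of empirical means -/

section Residual

variable {S A : Type*} [MeasurableSpace S] [MeasurableSpace A] {M : OPEProblem S A}

lemma measurable_residual (X : M.Op) (f : M.Fn) :
    Measurable fun z : (S × A) × Set.Icc (0 : ℝ) 1 × (S × A) =>
      (z.2.1 : ℝ) + M.γ * f.1 z.2.2 - (X f).1 z.1 := by
  have h1 := f.measurable
  have h2 := (X f).measurable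
  fun_prop

lemma abs_residual_le (X : M.Op) (f : M.Fn) (z : (S × A) × Set.Icc (0 : ℝ) 1 × (S × A)) :
    |(z.2.1 : ℝ) + M.γ * f.1 z.2.2 - (X f).1 z.1| ≤ 1 + M.γ * M.C := by
  have h1 := f.2.2 z.2.2
  have h2 := (X f).2.2 z.1
  have h3 := z.2.1.2
  have h4 := M.C_le_one_add
  have h5 := mul_le_mul_of_nonneg_left h1.2 M.γ_nonneg
  have h6 := mul_nonneg M.γ_nonneg h1.1
  rw [abs_le]
  constructor <;> linarith [h2.1, h2.2, h3.1, h3.2]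

variable {F : Type*} [NormedAddCommGroup F] [InnerProductSpace ℝ F] [CompleteSpace F]
  [RKHS ℝ F (S × A) ℝ]
  {κ : S × A → S × A → ℝ}

variable (F) in
/-- The temporal-difference residual of `X` at `f` on one data point `(u, r, u')`, times the
feature of `u`. -/
noncomputable def residualFeature (X : M.Op) (f : M.Fn)
    (z : (S × A) × Set.Icc (0 : ℝ) 1 × (S × A)) : F :=
  ((z.2.1 : ℝ) + M.γ * f.1 z.2.2 - (X f).1 z.1) • feature F z.1

lemma kernelLoss_eq (hF : IsRKHSOf F κ) {n : ℕ}
    (z : Fin n → (S × A) × Set.Icc (0 : ℝ) 1 × (S × A)) (X : M.Op) (f : M.Fn) :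
    M.kernelLoss κ z X f = ‖(n : ℝ)⁻¹ • ∑ i, residualFeature F X f (z i)‖ ^ 2 := by
  rw [norm_smul, mul_pow, norm_inv, Real.norm_natCast, inv_pow, ← one_div,
    ← real_inner_self_eq_norm_sq, kernelLoss, sum_inner]
  congr 1
  refine Finset.sum_congr rfl fun i _ => ?_
  rw [inner_sum]
  refine Finset.sum_congr rfl fun j _ => ?_
  rw [residualFeature, residualFeature, real_inner_smul_left, real_inner_smul_right,
    hF.inner_feature_feature]
  ring

variable [TopologicalSpace S] [TopologicalSpace A]

lemma norm_residualFeature_le (hF : IsRKHSOf F κ) (hκ : IsNormalizedKernel κ) (X : M.Op)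
    (f : M.Fn) (z : (S × A) × Set.Icc (0 : ℝ) 1 × (S × A)) :
    ‖residualFeature F X f z‖ ≤ 1 + M.γ * M.C := by
  rw [residualFeature, norm_smul]
  exact (mul_le_of_le_one_right (norm_nonneg _) (hF.norm_feature_le hκ _)).trans
    (abs_residual_le X f z)

end Residual

section KernelLoss

variable {S A : Type*} [MeasurableSpace S] [MeasurableSpace A] [TopologicalSpace S]
  [TopologicalSpace A] [CompactSpace (S × A)] [BorelSpace (S × A)] {M : OPEProblem S A}
  {κ : S × A → S × A → ℝ}
  {F : Type*} [NormedAddCommGroup F] [InnerProductSpace ℝ F] [CompleteSpace F]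
  [RKHS ℝ F (S × A) ℝ]

lemma stronglyMeasurable_residualFeature (hF : IsRKHSOf F κ) (hκ : IsNormalizedKernel κ)
    (X : M.Op) (f : M.Fn) : StronglyMeasurable (residualFeature F X f) := by
  have := hF.secondCountableTopology hκ
  exact (measurable_residual X f).stronglyMeasurable.smul
    ((hF.continuous_feature hκ).stronglyMeasurable.comp_measurable measurable_fst)

/-- The mean of the residual feature is minus the kernel mean embedding of the Bellman error. -/
theorem integral_residualFeature (hF : IsRKHSOf F κ) (hκ : IsNormalizedKernel κ) (X : M.Op)
    (f : M.Fn) :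
    ∫ z, residualFeature F X f z ∂M.dataLaw
      = -∫ u, M.Δ (M.toFun X) f u • feature F u ∂M.μ := by
  have hint : Integrable (residualFeature F X f) M.dataLaw :=
    Integrable.of_bound (stronglyMeasurable_residualFeature hF hκ X f).aestronglyMeasurable _
      (ae_of_all _ (norm_residualFeature_le hF hκ X f))
  unfold dataLaw at hint ⊢
  rw [Measure.integral_compProd hint, ← integral_neg]
  refine integral_congr_ae (ae_of_all _ fun u => ?_)
  simp only [residualFeature]
  rw [integral_smul_const, ← neg_smul, Kernel.prod_apply]
  congr 1
  have hr : Integrable (fun p : Set.Icc (0 : ℝ) 1 × (S × A) => (p.1 : ℝ))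
      ((M.reward u).prod (M.step u)) :=
    Integrable.of_mem_Icc 0 1 (by fun_prop) (ae_of_all _ fun p => p.1.2)
  have hf : Integrable (fun p : Set.Icc (0 : ℝ) 1 × (S × A) => M.γ * f.1 p.2)
      ((M.reward u).prod (M.step u)) :=
    (Integrable.of_mem_Icc 0 M.C (f.measurable.comp measurable_snd).aemeasurable
      (ae_of_all _ fun p => f.2.2 p.2)).const_mul _
  have h1 : ∫ p, (p.1 : ℝ) ∂((M.reward u).prod (M.step u)) = M.meanReward u := by
    simp [integral_fun_fst (fun r : Set.Icc (0 : ℝ) 1 => (r : ℝ)), meanReward]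
  have h2 : ∫ p, f.1 p.2 ∂((M.reward u).prod (M.step u)) = ∫ v, f.1 v ∂(M.step u) := by
    simp [integral_fun_snd (fun v => f.1 v)]
  have h3 := integral_sub (hr.add hf) (integrable_const ((X f).1 u))
  simp only [Pi.add_apply] at h3
  rw [integral_add hr hf, integral_const_mul, h1, h2] at h3
  refine h3.trans ?_
  simp [Δ, toFun, bellmanOp, bellman]

lemma abs_sqrt_kernelLoss_sub_dualNorm_le (hF : IsRKHSOf F κ) (hκ : IsNormalizedKernel κ) {n : ℕ}
    (z : Fin n → (S × A) × Set.Icc (0 : ℝ) 1 × (S × A)) (X : M.Op) (f : M.Fn) :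
    |√(M.kernelLoss κ z X f) - M.dualNorm F (M.Δ (M.toFun X) f)|
      ≤ ‖(n : ℝ)⁻¹ • ∑ i, residualFeature F X f (z i)
          - ∫ y, residualFeature F X f y ∂M.dataLaw‖ := by
  rw [kernelLoss_eq hF, Real.sqrt_sq (norm_nonneg _), integral_residualFeature hF hκ,
    dualNorm_eq_norm hF hκ (integrable_Δ X f _), ← norm_neg (∫ u, _ ∂M.μ)]
  exact abs_norm_sub_norm_le _ _

/-- Deterministic bound, used where the stochastic bound exceeds the range of the deviation. -/
lemma abs_sqrt_kernelLoss_sub_dualNorm_le_two_mul (hF : IsRKHSOf F κ) (hκ : IsNormalizedKernel κ)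
    {n : ℕ} (z : Fin n → (S × A) × Set.Icc (0 : ℝ) 1 × (S × A)) (X : M.Op) (f : M.Fn) :
    |√(M.kernelLoss κ z X f) - M.dualNorm F (M.Δ (M.toFun X) f)| ≤ 2 * (1 + M.γ * M.C) := by
  have hB := M.one_add_pos
  have h1 : ‖(n : ℝ)⁻¹ • ∑ i, residualFeature F X f (z i)‖ ≤ 1 + M.γ * M.C := by
    rw [norm_smul, norm_inv, Real.norm_natCast]
    have h := norm_sum_le_of_le Finset.univ (f := fun i => residualFeature F X f (z i))
      fun i _ => norm_residualFeature_le hF hκ X f (z i)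
    rw [Finset.sum_const, Finset.card_univ, Fintype.card_fin, nsmul_eq_mul] at h
    rcases Nat.eq_zero_or_pos n with rfl | hn
    · simpa using hB.le
    · rw [inv_mul_le_iff₀ (by exact_mod_cast hn)]
      exact h
  have h2 := dualNorm_Δ_le hF hκ X f
  have h3 := dualNorm_nonneg hF hκ (integrable_Δ X f M.μ)
  rw [kernelLoss_eq hF, Real.sqrt_sq (norm_nonneg _), abs_le]
  have h4 := norm_nonneg ((n : ℝ)⁻¹ • ∑ i, residualFeature F X f (z i))
  constructor <;> linarith

variable {Ω : Type*} [MeasurableSpace Ω] {Pr : Measure Ω} [IsProbabilityMeasure Pr]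

theorem measure_kernelLoss_deviation_le (hF : IsRKHSOf F κ) (hκ : IsNormalizedKernel κ)
    {Z : ℕ → Ω → (S × A) × Set.Icc (0 : ℝ) 1 × (S × A)} (hZ : ∀ i, Measurable (Z i))
    (hlaw : ∀ i, HasLaw (Z i) M.dataLaw Pr) (hind : iIndepFun Z Pr) (X : M.Op) (f : M.Fn)
    {n : ℕ} (hn : 1 ≤ n) {ε : ℝ} (hε : 0 ≤ ε) :
    Pr {ω | ε ≤ |√(M.kernelLoss κ (fun i : Fin n => Z i ω) X f)
        - M.dualNorm F (M.Δ (M.toFun X) f)|}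
      ≤ ENNReal.ofReal (Real.exp (1 / 2 - n * ε ^ 2 / (16 * (1 + M.γ * M.C) ^ 2))) := by
  have := hF.secondCountableTopology hκ
  let _ : MeasurableSpace F := borel F
  have : BorelSpace F := ⟨rfl⟩
  have hm := stronglyMeasurable_residualFeature hF hκ X f
  refine (measure_mono fun ω hω => ?_).trans
    (measure_le_norm_average_sub_le (V := fun i ω => residualFeature F X f (Z i ω))
      (fun i => hm.measurable.comp (hZ i))
      (hind.comp (fun _ => residualFeature F X f) fun _ => hm.measurable) M.one_add_pos
      (fun i ω => norm_residualFeature_le hF hκ X f _) (m := ∫ y, residualFeature F X f y ∂M.dataLaw)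
      (fun i => ?_) hn hε)
  · refine le_trans (show ε ≤ _ from hω)
      ((abs_sqrt_kernelLoss_sub_dualNorm_le hF hκ _ X f).trans_eq ?_)
    rw [Finset.sum_range]
  · rw [← (hlaw i).map_eq, integral_map (hZ i).aemeasurable hm.aestronglyMeasurable]

end KernelLoss

/-! ### Suboptimality of the kernel loss minimizer -/

section Suboptimality

variable {S A : Type*} [MeasurableSpace S] [MeasurableSpace A] {M : OPEProblem S A}
  {F : Type*} [NormedAddCommGroup F] [InnerProductSpace ℝ F] [RKHS ℝ F (S × A) ℝ] {φ : ℝ → ℝ}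

/-- Concavity and `φ 0 = 0` make `φ` subadditive. -/
lemma IsErrorLink.map_add_le (hφ : M.IsErrorLink F φ) {a b : ℝ} (ha : 0 ≤ a) (hb : 0 ≤ b) :
    φ (a + b) ≤ φ a + φ b := by
  rcases eq_or_lt_of_le (add_nonneg ha hb) with h | h
  · obtain rfl : a = 0 := by linarith
    obtain rfl : b = 0 := by linarith
    simp [hφ.zero]
  have key {t : ℝ} (ht : 0 ≤ t) (ht' : t ≤ a + b) : t / (a + b) * φ (a + b) ≤ φ t := by
    have h1 := hφ.concave.2 (Set.mem_Ici.2 h.le) (Set.mem_Ici.2 le_rfl)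
      (show 0 ≤ t / (a + b) by positivity) (sub_nonneg.2 ((div_le_one h).2 ht')) (by ring)
    simpa [hφ.zero, div_mul_cancel₀ _ h.ne'] using h1
  have h1 := key ha (by linarith)
  have h2 := key hb (by linarith)
  have h3 : a / (a + b) * φ (a + b) + b / (a + b) * φ (a + b) = φ (a + b) := by
    field_simp
  linarith

lemma abs_totalKernelLoss_sub_precriterion_le {n : ℕ}
    {z : Fin n → (S × A) × Set.Icc (0 : ℝ) 1 × (S × A)} {X : M.Op} {ε : ℝ}
    (hdev : ∀ h < M.H, |√(M.kernelLoss κ z X (M.Qiter X h))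
      - M.dualNorm F (M.Δ (M.toFun X) (M.Qiter X h))| ≤ ε) :
    |M.totalKernelLoss κ z X - M.precriterion F X| ≤ ε := by
  have hC := M.C_pos
  rw [totalKernelLoss, precriterion, ← mul_sub, ← Finset.sum_sub_distrib, abs_mul,
    abs_of_pos (one_div_pos.2 hC), one_div, inv_mul_le_iff₀ hC]
  refine (Finset.abs_sum_le_sum_abs _ _).trans ?_
  rw [← M.sum_weights, Finset.sum_mul]
  refine Finset.sum_le_sum fun h hh => ?_
  have hp := pow_nonneg M.γ_nonneg (M.H - 1 - h)
  rw [← mul_sub, abs_mul, abs_of_nonneg hp]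
  exact mul_le_mul_of_nonneg_left (hdev h (Finset.mem_range.1 hh)) hp

/-- A single candidate has no suboptimality. This case is special since `ln(H |𝒳| / δ)` may then be
arbitrarily close to `0`. -/
lemma subopt_eq_zero_of_card_eq_one {c : (M.Fn → S × A → ℝ) → ℝ} (hsel : M.IsSelectionCriterion c)
    {cand : Finset M.Op} (hc : cand.Nonempty) (hcard : cand.card = 1) {X : M.Op} (hX : X ∈ cand) :
    M.subopt (M.Qop X) cand hc c = 0 := by
  obtain ⟨Y, rfl⟩ := Finset.card_eq_one.1 hcard
  obtain rfl := Finset.mem_singleton.1 hX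
  rw [subopt, Finset.inf'_singleton]
  exact max_eq_left (sub_nonpos.2 (hsel.1 X))

end Suboptimality

section SuboptimalityBound

variable {S A : Type*} [MeasurableSpace S] [MeasurableSpace A] [TopologicalSpace S]
  [TopologicalSpace A] [CompactSpace (S × A)] [BorelSpace (S × A)] {M : OPEProblem S A}
  {κ : S × A → S × A → ℝ}
  {F : Type*} [NormedAddCommGroup F] [InnerProductSpace ℝ F] [CompleteSpace F]
  [RKHS ℝ F (S × A) ℝ] {φ : ℝ → ℝ}

lemma IsErrorLink.subopt_le (hφ : M.IsErrorLink F φ) (hF : IsRKHSOf F κ)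
    (hκ : IsNormalizedKernel κ) {cand : Finset M.Op} (hc : cand.Nonempty) {n : ℕ}
    {z : Fin n → (S × A) × Set.Icc (0 : ℝ) 1 × (S × A)} {X : M.Op} (hX : M.IsKLM κ z cand X)
    {ε : ℝ} (hε : 0 ≤ ε)
    (hdev : ∀ Y ∈ cand, ∀ h < M.H, |√(M.kernelLoss κ z Y (M.Qiter Y h))
      - M.dualNorm F (M.Δ (M.toFun Y) (M.Qiter Y h))| ≤ ε) :
    M.subopt (M.Qop X) cand hc (M.criterion F φ) ≤ φ (2 * ε) := by
  refine max_le (hφ.nonneg _ (by linarith)) ?_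
  obtain ⟨Y, hY, hYeq⟩ := cand.exists_mem_eq_inf' hc fun X => M.criterion F φ (M.toFun X)
  rw [hYeq, sub_le_iff_le_add']
  have h1 := abs_le.1 (abs_totalKernelLoss_sub_precriterion_le (hdev X hX.1))
  have h2 := abs_le.1 (abs_totalKernelLoss_sub_precriterion_le (hdev Y hY))
  have hY0 := precriterion_nonneg hF hκ Y
  have hYop := precriterion_le_opDualNorm hF hκ Y
  have hpre : M.precriterion F X ≤ M.opDualNorm F (M.Δ (M.toFun Y)) + 2 * ε := by
    linarith [hX.2 Y hY, h1.1, h2.2]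
  have hX0 := precriterion_nonneg hF hκ X
  calc |M.ΔJ (M.Qop X)| ≤ φ (M.precriterion F X) := hφ.error_bound X
    _ ≤ φ (M.opDualNorm F (M.Δ (M.toFun Y)) + 2 * ε) :=
        hφ.monotone hX0 (hX0.trans hpre) hpre
    _ ≤ φ (M.opDualNorm F (M.Δ (M.toFun Y))) + φ (2 * ε) :=
        hφ.map_add_le (hY0.trans hYop) (by linarith)

variable {Ω : Type*} [MeasurableSpace Ω] {Pr : Measure Ω}

/-- Union bound over the `H |𝒳|` pairs of a step and a candidate. The minimizer need not be measurable
in `ω`, so the bound is on an outer measure. -/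
lemma IsErrorLink.measure_subopt_le (hφ : M.IsErrorLink F φ) (hF : IsRKHSOf F κ)
    (hκ : IsNormalizedKernel κ) {cand : Finset M.Op} (hc : cand.Nonempty) {n : ℕ}
    {z : Ω → Fin n → (S × A) × Set.Icc (0 : ℝ) 1 × (S × A)} {Xhat : Ω → M.Op}
    (hX : ∀ ω, M.IsKLM κ (z ω) cand (Xhat ω)) {ε : ℝ} (hε : 0 ≤ ε) {p : ℝ≥0∞}
    (hp : ∀ (X : M.Op) (f : M.Fn), Pr {ω | ε ≤ |√(M.kernelLoss κ (z ω) X f)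
        - M.dualNorm F (M.Δ (M.toFun X) f)|} ≤ p) :
    Pr {ω | φ (2 * ε) < M.subopt (M.Qop (Xhat ω)) cand hc (M.criterion F φ)}
      ≤ (M.H * cand.card : ℕ) * p := by
  have hsub : {ω | φ (2 * ε) < M.subopt (M.Qop (Xhat ω)) cand hc (M.criterion F φ)}
      ⊆ ⋃ q ∈ Finset.range M.H ×ˢ cand, {ω | ε ≤ |√(M.kernelLoss κ (z ω) q.2 (M.Qiter q.2 q.1))
        - M.dualNorm F (M.Δ (M.toFun q.2) (M.Qiter q.2 q.1))|} := by
    intro ω hω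
    by_contra hnot
    simp only [Set.mem_iUnion, Set.mem_ofPred_eq, exists_prop, not_exists, not_and, not_le,
      Prod.forall, Finset.mem_product, Finset.mem_range] at hnot
    exact absurd hω (not_lt.2 (hφ.subopt_le hF hκ hc (hX ω) hε
      fun Y hY h hh => (hnot h Y ⟨hh, hY⟩).le))
  refine (measure_mono hsub).trans ((measure_biUnion_finset_le _ _).trans ?_)
  refine (Finset.sum_le_card_nsmul _ _ p fun q _ => hp q.2 _).trans_eq ?_
  rw [Finset.card_product, Finset.card_range, nsmul_eq_mul]

variable [IsProbabilityMeasure Pr] {Z : ℕ → Ω → (S × A) × Set.Icc (0 : ℝ) 1 × (S × A)}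
  {Xhat : ℕ → Ω → M.Op}

theorem IsErrorLink.isOptimal (hφ : M.IsErrorLink F φ) (hF : IsRKHSOf F κ)
    (hκ : IsNormalizedKernel κ) {cand : Finset M.Op} (hc : cand.Nonempty)
    (hZ : ∀ i, Measurable (Z i)) (hlaw : ∀ i, HasLaw (Z i) M.dataLaw Pr) (hind : iIndepFun Z Pr)
    (hX : ∀ n ω, M.IsKLM κ (fun i : Fin n => Z i ω) cand (Xhat n ω)) :
    M.IsOptimal Pr (fun n ω => M.Qop (Xhat n ω)) cand hc (M.criterion F φ) := by
  refine tendstoInMeasure_of_ne_top fun η hη hηtop => ?_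
  obtain ⟨d, hd, hdφ⟩ := Metric.continuousWithinAt_iff.1
    (hφ.continuous 0 (le_refl (0 : ℝ))) η.toReal (ENNReal.toReal_pos hη.ne' hηtop)
  -- The link function is evaluated at `2 ε`, which has to stay below `d`.
  set ε : ℝ := d / 4 with hε
  have hε0 : 0 < ε := by positivity
  have hφε : φ (2 * ε) < η.toReal := by
    have h := hdφ (x := 2 * ε) (show (0 : ℝ) ≤ 2 * ε by positivity) (by
      rw [Real.dist_eq, sub_zero, abs_of_pos (by positivity)]
      linarith)
    rw [hφ.zero, Real.dist_eq, sub_zero] at h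
    exact (le_abs_self _).trans_lt h
  have hB := M.one_add_pos
  set r : ℝ := ε ^ 2 / (16 * (1 + M.γ * M.C) ^ 2) with hr
  have hr0 : 0 < r := by positivity
  have hlim : Tendsto (fun n : ℕ => ((M.H * cand.card : ℕ) : ℝ≥0∞)
      * ENNReal.ofReal (Real.exp (1 / 2 - n * r))) atTop (nhds 0) := by
    have h1 : Tendsto (fun n : ℕ => Real.exp (1 / 2 - n * r)) atTop (nhds 0) := by
      refine Real.tendsto_exp_atBot.comp (tendsto_atBot_add_const_left atTop (1 / 2) ?_)
      exact tendsto_neg_atTop_atBot.comp (tendsto_natCast_atTop_atTop.atTop_mul_const hr0)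
    have h2 := ENNReal.Tendsto.const_mul (a := ((M.H * cand.card : ℕ) : ℝ≥0∞))
      (ENNReal.tendsto_ofReal h1) (Or.inr (ENNReal.natCast_ne_top _))
    simpa using h2
  refine tendsto_of_tendsto_of_tendsto_of_le_of_le' tendsto_const_nhds hlim
    (Eventually.of_forall fun _ => zero_le) ?_
  filter_upwards [eventually_ge_atTop 1] with n hn
  refine (measure_mono fun ω hω => ?_).trans
    (hφ.measure_subopt_le hF hκ hc (hX n) hε0.le
      fun X f => (measure_kernelLoss_deviation_le hF hκ hZ hlaw hind X f hn hε0.le).trans_eq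
        (by rw [hr, mul_div_assoc]))
  have hω' : η ≤ edist (M.subopt (M.Qop (Xhat n ω)) cand hc (M.criterion F φ)) 0 := hω
  rw [edist_dist, Real.dist_eq, sub_zero, abs_of_nonneg (le_max_left _ _)] at hω'
  exact hφε.trans_le (ENNReal.toReal_le_of_le_ofReal (le_max_left _ _) hω')

theorem IsErrorLink.measure_subopt_gt_le (hφ : M.IsErrorLink F φ) (hF : IsRKHSOf F κ)
    (hκ : IsNormalizedKernel κ) {cand : Finset M.Op} (hc : cand.Nonempty)
    (hZ : ∀ i, Measurable (Z i)) (hlaw : ∀ i, HasLaw (Z i) M.dataLaw Pr) (hind : iIndepFun Z Pr)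
    (hX : ∀ n ω, M.IsKLM κ (fun i : Fin n => Z i ω) cand (Xhat n ω)) {n : ℕ} (hn : 1 ≤ n)
    {δ : ℝ} (hδ : 0 < δ) (hδ1 : δ < 1) :
    Pr {ω | ENNReal.ofReal (24 * M.C ^ 2
          * (Real.log (M.H * cand.card / δ) / n) ^ (1 / 4 : ℝ)) * M.wMax F
        < ENNReal.ofReal (M.subopt (M.Qop (Xhat n ω)) cand hc (M.criterion F φ))}
      ≤ ENNReal.ofReal δ := by
  by_cases hcard : cand.card = 1
  · have h0 (ω : Ω) : M.subopt (M.Qop (Xhat n ω)) cand hc (M.criterion F φ) = 0 :=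
      subopt_eq_zero_of_card_eq_one (hφ.isSelectionCriterion hF hκ) hc hcard (hX n ω).1
    simp [h0]
  -- With two candidates, `t ≥ ln 2 ≥ 1 / 2` absorbs the factor `exp (1 / 2)` of the tail bound.
  have hcard2 : 2 ≤ cand.card := by have := hc.card_pos; omega
  have hN2 : (2 : ℝ) ≤ M.H * cand.card := by
    exact_mod_cast hcard2.trans (Nat.le_mul_of_pos_left _ M.one_le_H)
  set t : ℝ := Real.log (M.H * cand.card / δ) with ht
  have ht2 : 1 / 2 ≤ t := by
    have h1 : Real.log 2 ≤ t := by
      refine Real.log_le_log two_pos (hN2.trans ?_)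
      rw [le_div_iff₀ hδ]
      nlinarith
    linarith [Real.log_two_gt_d9]
  have hexp : Real.exp (-t) = δ / (M.H * cand.card) := by
    rw [Real.exp_neg, ht, Real.exp_log (by positivity), inv_div]
  have hn0 : (0 : ℝ) < n := by exact_mod_cast hn
  set r : ℝ := (t / n) ^ (1 / 4 : ℝ) with hr
  have hr0 : 0 ≤ r := Real.rpow_nonneg (by positivity) _
  have hr4 : r ^ 4 = t / n := by
    rw [hr, ← Real.rpow_natCast, ← Real.rpow_mul (by positivity)]
    norm_num
  have hC := M.C_pos
  have hB := M.one_add_pos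
  have hBC := M.one_add_le_two_mul_C
  set ε : ℝ := 12 * M.C * r with hε
  have hε0 : 0 ≤ ε := by positivity
  have hdev (X : M.Op) (f : M.Fn) : Pr {ω | ε ≤ |√(M.kernelLoss κ (fun i : Fin n => Z i ω) X f)
        - M.dualNorm F (M.Δ (M.toFun X) f)|} ≤ ENNReal.ofReal (Real.exp (-t)) := by
    -- For `r ≤ 1` the rate `r` dominates the sub-Gaussian rate `r ^ 2`; for `r > 1` the event is empty.
    rcases le_or_gt r 1 with hr1 | hr1
    · refine (measure_kernelLoss_deviation_le hF hκ hZ hlaw hind X f hn hε0).trans ?_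
      refine ENNReal.ofReal_le_ofReal (Real.exp_le_exp.2 ?_)
      have h1 : t ≤ n * r ^ 2 := by
        have : r ^ 4 ≤ r ^ 2 := pow_le_pow_of_le_one hr0 hr1 (by norm_num)
        rw [hr4, div_le_iff₀ hn0] at this
        linarith
      have h2 : 2 * t ≤ n * ε ^ 2 / (16 * (1 + M.γ * M.C) ^ 2) := by
        rw [le_div_iff₀ (by positivity)]
        calc 2 * t * (16 * (1 + M.γ * M.C) ^ 2) ≤ 2 * t * (16 * (2 * M.C) ^ 2) := by gcongr
          _ = 128 * M.C ^ 2 * t := by ring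
          _ ≤ 144 * M.C ^ 2 * t := by gcongr; norm_num
          _ ≤ 144 * M.C ^ 2 * (n * r ^ 2) := by gcongr
          _ = n * ε ^ 2 := by rw [hε]; ring
      linarith
    · have hempty : {ω | ε ≤ |√(M.kernelLoss κ (fun i : Fin n => Z i ω) X f)
          - M.dualNorm F (M.Δ (M.toFun X) f)|} = ∅ := by
        refine Set.eq_empty_of_forall_notMem fun ω hω => ?_
        have h1 : ε ≤ 2 * (1 + M.γ * M.C) :=
          le_trans hω (abs_sqrt_kernelLoss_sub_dualNorm_le_two_mul hF hκ _ X f)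
        have h2 : 12 * M.C < ε := by rw [hε]; nlinarith
        linarith
      rw [hempty, measure_empty]
      exact zero_le
  have hfinal := hφ.measure_subopt_le hF hκ hc (hX n) hε0 hdev
  refine (measure_mono fun ω hω => ?_).trans (hfinal.trans_eq ?_)
  · have hlin := hφ.linear_bound (2 * ε) (by positivity)
    have hrate : M.C * (2 * ε) = 24 * M.C ^ 2 * r := by rw [hε]; ring
    rw [hrate] at hlin
    exact (ENNReal.ofReal_lt_ofReal_iff_of_nonneg (hφ.nonneg _ (by positivity))).1
      (hlin.trans_lt hω)
  · rw [hexp, ← ENNReal.ofReal_natCast, ← ENNReal.ofReal_mul (Nat.cast_nonneg _)]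
    push_cast
    rw [mul_div_cancel₀ _ (by positivity)]

end SuboptimalityBound

end KLM.OPEProblem

theorem proposition5 :
    ∃ K : ℝ, 0 < K ∧
      ∀ (S A : Type*) [MeasurableSpace S] [MeasurableSpace A] [TopologicalSpace S]
        [TopologicalSpace A] [CompactSpace (S × A)] [BorelSpace (S × A)]
        (M : KLM.OPEProblem S A) [M.μ.IsOpenPosMeasure] (_ : M.SufficientExploration)
        (κ : S × A → S × A → ℝ) (_ : KLM.IsNormalizedKernel κ)
        (F : Type*) [NormedAddCommGroup F] [InnerProductSpace ℝ F] [CompleteSpace F]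
        [RKHS ℝ F (S × A) ℝ] (_ : KLM.IsRKHSOf F κ) (_ : M.DenseInL1 F),
        M.IsErrorLink F (M.link F) ∧
        ∀ φ : ℝ → ℝ, M.IsErrorLink F φ →
          M.IsSelectionCriterion (M.criterion F φ) ∧
          ∀ (cand : Finset M.Op) (hc : cand.Nonempty)
            (Ω : Type*) [MeasurableSpace Ω] (Pr : Measure Ω) [IsProbabilityMeasure Pr]
            (Z : ℕ → Ω → (S × A) × Set.Icc (0 : ℝ) 1 × (S × A))
            (_ : ∀ i, Measurable (Z i)) (_ : ∀ i, HasLaw (Z i) M.dataLaw Pr) (_ : iIndepFun Z Pr)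
            (Xhat : ℕ → Ω → M.Op)
            (_ : ∀ n ω, M.IsKLM κ (fun i : Fin n => Z i ω) cand (Xhat n ω)),
            M.IsOptimal Pr (fun n ω => M.Qop (Xhat n ω)) cand hc (M.criterion F φ) ∧
            ∀ (n : ℕ) (_ : 1 ≤ n) (δ : ℝ) (_ : 0 < δ) (_ : δ < 1),
              Pr {ω | ENNReal.ofReal (K * M.C ^ 2
                    * (Real.log (M.H * cand.card / δ) / n) ^ (1 / 4 : ℝ)) * M.wMax F
                  < ENNReal.ofReal (M.subopt (M.Qop (Xhat n ω)) cand hc (M.criterion F φ))}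
                ≤ ENNReal.ofReal δ := by
  refine ⟨24, by norm_num, ?_⟩
  intro S A _ _ _ _ _ _ M _ hexp κ hκ F _ _ _ _ hF hdense
  refine ⟨KLM.OPEProblem.isErrorLink_link hexp hF hκ hdense, fun φ hφ =>
    ⟨hφ.isSelectionCriterion hF hκ, ?_⟩⟩
  intro cand hc Ω _ Pr _ Z hZ hlaw hind Xhat hX
  exact ⟨hφ.isOptimal hF hκ hc hZ hlaw hind hX, fun n hn δ hδ hδ1 =>
    hφ.measure_subopt_gt_le hF hκ hc hZ hlaw hind hX hn hδ hδ1⟩
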